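/- **Theorem 1.** Let $(W_t)_{t\ge0}$ be a standard Brownian motion and let $P_t$ be the geometric Brownian motion $dP_t/P_t=\mu\,dt+\sigma\,dW_t$, i.e. $P_t=P_0e^{(\mu-\sigma^2/2)t+\sigma W_t}$, with $P_0>0$, $\mu\in\mathbb R$, $\sigma>0$. Let the ask price of a Dutch auction be $A_t=A_0e^{-\lambda t}$ with $A_0,\lambda>0$. Let blocks be generated at the event times of a Poisson process of rate $1/\Delta t$, $\Delta t>0$, independent of $W$. Put $z_t=\log(A_t/P_t)$, so that $z_0=\log(A_0/P_0)$, and let $\tau_F$ be the earliest block generation time with $z_{\tau_F}\le 0$. Define $$\mathsf{LVF}(z_0)=\mathbb E\big[1-e^{z_{\tau_F}}\big]=\mathbb E\Big[\tfrac{P_{\tau_F}-A_{\tau_F}}{P_{\tau_F}}\Big],\qquad \mathsf{FT}(z_0)=\mathbb E[\tau_F].$$ Assume $\delta:=\lambda+\mu-\tfrac12\sigma^2>0$, and let $$\zeta_-:=\frac{\delta}{\sigma^2}\left(\sqrt{1+\frac{2\sigma^2}{\delta^2\Delta t}}-1\right),\qquad \eta:=\frac{\delta}{\sigma^2}\left(\sqrt{1+\frac{2\sigma^2}{\delta^2\Delta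 t}}+1\right)=\zeta_-+\frac{2\delta}{\sigma^2}.$$ Then $\tau_F<\infty$ almost surely, both expectations are well defined and finite, and the following hold. If $z_0\ge0$, then $$\mathsf{LVF}(z_0)=\frac1{1+\zeta_-}=\frac{1}{1+\frac{\delta}{\sigma^2}\left(\sqrt{1+\frac{2\sigma^2}{\delta^2\Delta t}}-1\right)}=:\mathsf{LVF}_+,\qquad \mathsf{FT}(z_0)=\frac{z_0}{\delta}+\frac{\Delta t}{2}\left(1+\sqrt{1+\frac{2\sigma^2}{\delta^2\Delta t}}\right).$$ If $z_0<0$, then $$\mathsf{FT}(z_0)=\frac{\Delta t}{2}\left(2+\left(\sqrt{1+\frac{2\sigma^2}{\delta^2\Delta t}}-1\right)e^{\eta z_0}\right),$$ and, provided that $1+\Delta t(\delta-\tfrac12\sigma^2)\ne0$, $$\mathsf{LVF}(z_0)=1-\frac{e^{z_0}}{1+\Delta t(\delta-\frac12\sigma^2)}+\left(\frac1{1+\zeta_-}-\frac{\Delta t(\delta-\frac12\sigma^2)}{1+\Delta t(\delta-\frac12\sigma^2)}\right)e^{\eta z_0}.$$ -/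

import Mathlib

open MeasureTheory ProbabilityTheory
open scoped NNReal

noncomputable section

namespace DutchAuction

variable {Ω : Type*}

/-- Geometric Brownian motion with initial value `P₀`, drift `μ` and volatility `σ`, driven by `W`:
the solution `P₀ exp ((μ - σ²/2) t + σ W_t)` of `dP_t / P_t = μ dt + σ dW_t`. -/
def price (P₀ μ σ : ℝ) (W : ℝ≥0 → Ω → ℝ) (t : ℝ≥0) (ω : Ω) : ℝ :=
  P₀ * Real.exp ((μ - σ ^ 2 / 2) * (t : ℝ) + σ * W t ω)

/-- The ask price `A₀ exp (-λ t)`, i.e. the solution of `dA_t / A_t = -λ dt`. -/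
def ask (A₀ lam : ℝ) (t : ℝ≥0) : ℝ :=
  A₀ * Real.exp (-lam * (t : ℝ))

/-- The log mispricing `z_t = log (A_t / P_t)`. -/
def mispricing (A₀ lam P₀ μ σ : ℝ) (W : ℝ≥0 → Ω → ℝ) (t : ℝ≥0) (ω : Ω) : ℝ :=
  Real.log (ask A₀ lam t / price P₀ μ σ W t ω)

/-- `gap` is the sequence of waiting times between consecutive events (the first one counted from
time `0`) of a Poisson process of rate `r`: they are i.i.d. exponential of rate `r`. -/
structure IsPoissonGaps [MeasurableSpace Ω] (gap : ℕ → Ω → ℝ≥0) (r : ℝ) (P : Measure Ω) :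
    Prop where
  measurable : ∀ n, Measurable (gap n)
  indep : iIndepFun gap P
  law : ∀ n, HasLaw (fun ω ↦ (gap n ω : ℝ)) (expMeasure r) P

/-- The block generation times: `blockTime gap n` is the time of the `(n+1)`-st block. -/
def blockTime (gap : ℕ → Ω → ℝ≥0) (n : ℕ) (ω : Ω) : ℝ≥0 :=
  ∑ i ∈ Finset.range (n + 1), gap i ω

/-- The index of the block in which the order is filled: the first block at whose generation time
the process `z` is nonpositive (`0` by convention if there is no such block). -/
def fillBlock (z : ℝ≥0 → Ω → ℝ) (gap : ℕ → Ω → ℝ≥0) (ω : Ω) : ℕ :=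
  sInf {n : ℕ | z (blockTime gap n ω) ω ≤ 0}

/-- The fill time `τ_F`: the earliest block generation time at which `z` is nonpositive. -/
def fillTime (z : ℝ≥0 → Ω → ℝ) (gap : ℕ → Ω → ℝ≥0) (ω : Ω) : ℝ≥0 :=
  blockTime gap (fillBlock z gap ω) ω

/-- The relative loss `1 - exp z_{τ_F}`; for `z = log (A / P)` it equals
`(P_{τ_F} - A_{τ_F}) / P_{τ_F}`. -/
def relLoss (z : ℝ≥0 → Ω → ℝ) (gap : ℕ → Ω → ℝ≥0) (ω : Ω) : ℝ :=
  1 - Real.exp (z (fillTime z gap ω) ω)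

/-- Loss-versus-fair: the expected relative loss. -/
def LVF [MeasurableSpace Ω] (z : ℝ≥0 → Ω → ℝ) (gap : ℕ → Ω → ℝ≥0) (P : Measure Ω) : ℝ :=
  ∫ ω, relLoss z gap ω ∂P

/-- Time-to-fill: the expected fill time. -/
def FT [MeasurableSpace Ω] (z : ℝ≥0 → Ω → ℝ) (gap : ℕ → Ω → ℝ≥0) (P : Measure Ω) : ℝ :=
  ∫ ω, (fillTime z gap ω : ℝ) ∂P

/-- `ζ₋ = (δ / σ²) (√(1 + 2 σ² / (δ² Δt)) - 1)`. -/
def zetaMinus (δ σ Δt : ℝ) : ℝ :=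
  δ / σ ^ 2 * (√(1 + 2 * σ ^ 2 / (δ ^ 2 * Δt)) - 1)

end DutchAuction

end

/-!
The log mispricing is `z_t = z₀ - (δ t + σ W_t)`. Sampled at the block times it is a random walk
`S_n = z₀ - (X_0 + … + X_{n-1})` with i.i.d. steps, and `τ_F` is the sum of the waiting times up to
the first `n ≥ 1` with `S_n ≤ 0`. The proof computes with this walk.

*The steps.* Since `W` is independent of the waiting times, conditioning on the latter reduces the
joint law of the pairs (waiting time, step) to that of Brownian increments over deterministic times,
which are independent Gaussians; integrating over the independent waiting times gives a product
(`iIndepFun_gap_driftStep`). Comparing characteristic functions, the law of one step is asymmetric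
Laplace (`map_exp_prod_gaussian`): with `α = ζ₋` and `β = η`, a step is exponential of rate `α` on
the positive half-line and reflected exponential of rate `β` on the negative one, because
`α β = 2 / (σ² Δt)` and `β - α = 2 δ / σ²`.

*The loss.* By lack of memory the walk enters `(-∞, 0]` from a nonnegative level with an
exponential undershoot of rate `α`. Accordingly the function `lossFn`, equal to `1 - exp y` for
`y ≤ 0` and to `1 / (1 + α)` for `y > 0`, reproduces the value `1 / (1 + α)` when averaged over one
step from any nonnegative level (`integral_lossFn_of_nonneg`), and optional stopping
(`integral_lossFn_exit`) shows that the expected loss is the mean of `lossFn (z₀ - X)` over one step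
`X`, whatever the sign of `z₀`.

*The time.* The function `timeFn`, equal to `0` for `y ≤ 0` and to `y + 1 / α` for `y > 0`,
decreases by `1 / α - 1 / β = δ Δt` per block on average while the order is alive. Summing this over
the blocks gives the expected number of blocks (`hasSum_measureReal_aliveSet`); the boundary term
vanishes since `exp (θ S_n)` has geometrically decaying mean for small `θ > 0`. As each waiting time
has mean `Δt` and is independent of the order being alive at its start, this gives the expected fill
time (`lintegral_sum_gap`), and also that the fill happens almost surely.
-/

namespace DutchAuction

open Set Filter Topology

/-! ### Integrals against the exponential law -/

lemma expMeasure_eq_withDensity (r : ℝ) :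
    expMeasure r = (volume.restrict (Ioi 0)).withDensity
      (fun x ↦ ENNReal.ofReal (r * Real.exp (-(r * x)))) := by
  have h : expMeasure r = volume.withDensity (exponentialPDF r) := rfl
  rw [h, restrict_Ioi_eq_restrict_Ici, ← withDensity_indicator measurableSet_Ici]
  congr 1
  ext x
  rw [exponentialPDF_eq, indicator_apply]
  simp only [mem_Ici]
  split_ifs <;> simp

lemma integral_expMeasure {r : ℝ} (hr : 0 < r) {E : Type*} [NormedAddCommGroup E]
    [NormedSpace ℝ E] (f : ℝ → E) :
    ∫ x, f x ∂expMeasure r = ∫ x in Ioi 0, (r * Real.exp (-(r * x))) • f x := by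
  rw [expMeasure_eq_withDensity, integral_withDensity_eq_integral_toReal_smul (by fun_prop)
    (by simp)]
  refine integral_congr_ae (ae_of_all _ fun x ↦ ?_)
  simp only
  rw [ENNReal.toReal_ofReal (by positivity)]

lemma integrable_expMeasure_iff {r : ℝ} (hr : 0 < r) {E : Type*} [NormedAddCommGroup E]
    [NormedSpace ℝ E] (f : ℝ → E) :
    Integrable f (expMeasure r) ↔
      IntegrableOn (fun x ↦ (r * Real.exp (-(r * x))) • f x) (Ioi 0) := by
  rw [expMeasure_eq_withDensity, integrable_withDensity_iff_integrable_smul' (by fun_prop)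
    (by simp), IntegrableOn]
  refine integrable_congr (ae_of_all _ fun x ↦ ?_)
  simp only
  rw [ENNReal.toReal_ofReal (by positivity)]

lemma ae_pos_expMeasure (r : ℝ) : ∀ᵐ x ∂expMeasure r, 0 < x := by
  rw [expMeasure_eq_withDensity]
  exact (withDensity_absolutelyContinuous _ _).ae_le (ae_restrict_mem measurableSet_Ioi)

lemma ae_nonneg_expMeasure (r : ℝ) : ∀ᵐ x ∂expMeasure r, 0 ≤ x :=
  (ae_pos_expMeasure r).mono fun _ hx ↦ hx.le

lemma integral_cexp_expMeasure {r : ℝ} (hr : 0 < r) {w : ℂ} (hw : w.re < r) :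
    ∫ x : ℝ, Complex.exp (w * x) ∂expMeasure r = r / (r - w) := by
  rw [integral_expMeasure hr]
  have h (x : ℝ) : (r * Real.exp (-(r * x))) • Complex.exp (w * x) =
      r * Complex.exp ((w - r) * x) := by
    rw [Complex.real_smul]
    push_cast
    rw [mul_assoc, ← Complex.exp_add]
    ring_nf
  simp_rw [h]
  rw [integral_const_mul, integral_exp_mul_complex_Ioi (by simpa using hw)]
  have h' : (r : ℂ) - w ≠ 0 := by
    intro h0
    have := congrArg Complex.re h0
    simp at this
    linarith
  have h'' : w - (r : ℂ) ≠ 0 := by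
    rw [← neg_sub]; exact neg_ne_zero.2 h'
  simp
  field_simp
  ring

lemma integrable_exp_expMeasure {r s : ℝ} (hr : 0 < r) (hs : s < r) :
    Integrable (fun x ↦ Real.exp (s * x)) (expMeasure r) := by
  rw [integrable_expMeasure_iff hr]
  have := (integrableOn_exp_mul_Ioi (a := s - r) (by linarith) 0).const_mul r
  refine this.congr (ae_of_all _ fun x ↦ ?_)
  simp only [smul_eq_mul]
  rw [mul_assoc, ← Real.exp_add]
  ring_nf

lemma integral_exp_expMeasure {r s : ℝ} (hr : 0 < r) (hs : s < r) :
    ∫ x, Real.exp (s * x) ∂expMeasure r = r / (r - s) := by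
  have h := integral_cexp_expMeasure hr (w := s) (by simpa using hs)
  simp_rw [← Complex.ofReal_mul, ← Complex.ofReal_exp] at h
  rw [integral_complex_ofReal] at h
  exact_mod_cast h

lemma integrable_id_expMeasure {r : ℝ} (hr : 0 < r) :
    Integrable (fun x : ℝ ↦ x) (expMeasure r) := by
  have h := (integrable_exp_expMeasure hr (s := r / 2) (by linarith)).const_mul (2 / r)
  refine h.mono' (by fun_prop) ?_
  filter_upwards [ae_nonneg_expMeasure r] with x hx
  rw [Real.norm_of_nonneg hx, div_mul_eq_mul_div, le_div_iff₀ hr]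
  have := Real.add_one_le_exp (r / 2 * x)
  nlinarith

lemma integral_id_expMeasure {r : ℝ} (hr : 0 < r) :
    ∫ x, x ∂expMeasure r = r⁻¹ := by
  rw [integral_expMeasure hr]
  have h := Real.integral_rpow_mul_exp_neg_mul_Ioi (a := 2) (by norm_num) hr
  have h2 : ∀ x ∈ Ioi (0 : ℝ), (r * Real.exp (-(r * x))) • x =
      r * (x ^ ((2 : ℝ) - 1) * Real.exp (-(r * x))) := by
    intro x hx
    have : (2 : ℝ) - 1 = 1 := by norm_num
    rw [this, Real.rpow_one, smul_eq_mul]; ring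
  rw [setIntegral_congr_fun measurableSet_Ioi h2, integral_const_mul, h]
  rw [Real.Gamma_two, Real.rpow_two]
  field_simp

/-- Lack of memory of the exponential law: beyond the level `z` it starts afresh. Up to the level
`z` the integral is evaluated through an antiderivative `F`. -/
lemma integral_expMeasure_split {r z : ℝ} (hr : 0 < r) (hz : 0 ≤ z) {f F : ℝ → ℝ}
    (hf : Integrable f (expMeasure r)) (hF : Continuous F)
    (hd : ∀ x ∈ Ioo 0 z, HasDerivAt F (r * Real.exp (-(r * x)) * f x) x) :
    ∫ x, f x ∂expMeasure r = F z - F 0 +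
      Real.exp (-(r * z)) * ∫ x, f (z + x) ∂expMeasure r := by
  rw [integrable_expMeasure_iff hr] at hf
  have hi : IntervalIntegrable (fun x ↦ r * Real.exp (-(r * x)) * f x) volume 0 z :=
    (intervalIntegrable_iff_integrableOn_Ioc_of_le hz).2 (hf.mono_set Ioc_subset_Ioi_self)
  rw [← intervalIntegral.integral_eq_sub_of_hasDerivAt_of_le hz hF.continuousOn hd hi,
    integral_expMeasure hr, integral_expMeasure hr, ← integral_const_mul,
    intervalIntegral.integral_of_le hz]
  have h1 : ∫ x in Ioi 0, Real.exp (-(r * z)) * (r * Real.exp (-(r * x))) • f (z + x) =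
      ∫ x in Ioi z, (r * Real.exp (-(r * x))) • f x := by
    have := (measurePreserving_add_left volume z).setIntegral_preimage_emb
      (measurableEmbedding_addLeft z) (fun x ↦ (r * Real.exp (-(r * x))) • f x) (Ioi z)
    rw [← this]
    simp only [preimage_const_add_Ioi, sub_self]
    refine integral_congr_ae (ae_of_all _ fun x ↦ ?_)
    simp only [smul_eq_mul]
    rw [mul_add, neg_add, Real.exp_add]
    ring
  simp only [← smul_eq_mul (a := r * _)] at h1 ⊢
  rw [h1, ← setIntegral_union (Ioc_disjoint_Ioi le_rfl) measurableSet_Ioi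
    (hf.mono_set Ioc_subset_Ioi_self) (hf.mono_set (Ioi_subset_Ioi hz)), Ioc_union_Ioi_eq_Ioi hz]

/-! ### The asymmetric Laplace law -/

/-- The asymmetric Laplace law: density proportional to `exp (-α x)` for `x > 0` and to
`exp (β x)` for `x < 0`, written as the mixture of an exponential law of rate `α` on the positive
half-line and a reflected exponential law of rate `β` on the negative one. -/
noncomputable def asymLaplace (α β : ℝ) : Measure ℝ :=
  ENNReal.ofReal (β / (α + β)) • expMeasure α +
    ENNReal.ofReal (α / (α + β)) • (expMeasure β).map (fun x ↦ -x)

lemma isProbabilityMeasure_asymLaplace {α β : ℝ} (hα : 0 < α) (hβ : 0 < β) :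
    IsProbabilityMeasure (asymLaplace α β) := by
  have := isProbabilityMeasure_expMeasure hα
  have := isProbabilityMeasure_expMeasure hβ
  refine ⟨?_⟩
  simp only [asymLaplace, Measure.coe_add, Measure.coe_smul, Pi.add_apply, Pi.smul_apply,
    measure_univ, smul_eq_mul, mul_one]
  rw [Measure.map_apply (by fun_prop) MeasurableSet.univ, preimage_univ, measure_univ, mul_one,
    ← ENNReal.ofReal_add (by positivity) (by positivity), ← add_div, add_comm β α,
    div_self (by positivity), ENNReal.ofReal_one]

lemma integrable_asymLaplace {α β : ℝ} {E : Type*} [NormedAddCommGroup E] {f : ℝ → E}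
    (hf : Integrable f (expMeasure α)) (hf' : Integrable (fun x ↦ f (-x)) (expMeasure β)) :
    Integrable f (asymLaplace α β) := by
  refine (hf.smul_measure ENNReal.ofReal_ne_top).add_measure
    (Integrable.smul_measure ?_ ENNReal.ofReal_ne_top)
  exact ((MeasurableEquiv.neg ℝ).measurableEmbedding.integrable_map_iff).2 hf'

lemma integral_asymLaplace {α β : ℝ} (hα : 0 < α) (hβ : 0 < β)
    {E : Type*} [NormedAddCommGroup E] [NormedSpace ℝ E] {f : ℝ → E}
    (hf : Integrable f (expMeasure α)) (hf' : Integrable (fun x ↦ f (-x)) (expMeasure β)) :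
    ∫ x, f x ∂asymLaplace α β = (β / (α + β)) • ∫ x, f x ∂expMeasure α +
      (α / (α + β)) • ∫ x, f (-x) ∂expMeasure β := by
  have h := ((MeasurableEquiv.neg ℝ).measurableEmbedding.integrable_map_iff
    (μ := expMeasure β)).2 hf'
  have h2 := (MeasurableEquiv.neg ℝ).measurableEmbedding.integral_map (μ := expMeasure β) f
  change Integrable f ((expMeasure β).map (fun x ↦ -x)) at h
  change ∫ x, f x ∂(expMeasure β).map (fun x ↦ -x) = ∫ x, f (-x) ∂expMeasure β at h2
  rw [asymLaplace, integral_add_measure (hf.smul_measure ENNReal.ofReal_ne_top)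
    (Integrable.smul_measure h ENNReal.ofReal_ne_top), integral_smul_measure,
    integral_smul_measure, ENNReal.toReal_ofReal (by positivity),
    ENNReal.toReal_ofReal (by positivity), h2]

lemma charFun_asymLaplace {α β : ℝ} (hα : 0 < α) (hβ : 0 < β) (u : ℝ) :
    charFun (asymLaplace α β) u =
      α * β / (α * β - u ^ 2 * Complex.I ^ 2 - (β - α) * (u * Complex.I)) := by
  have hα' := isProbabilityMeasure_expMeasure hα
  have hβ' := isProbabilityMeasure_expMeasure hβ
  have hint {r : ℝ} (hr : IsProbabilityMeasure (expMeasure r)) (w : ℂ) (hw : w.re = 0) :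
      Integrable (fun x : ℝ ↦ Complex.exp (w * x)) (expMeasure r) := by
    refine Integrable.of_bound (by fun_prop) 1 (ae_of_all _ fun x ↦ ?_)
    simp [Complex.norm_exp, hw]
  have h1 := hint hα' (u * Complex.I) (by simp)
  have h2 := hint hβ' (-(u * Complex.I)) (by simp)
  have hc (x : ℝ) : Complex.exp (u * x * Complex.I) = Complex.exp (u * Complex.I * x) := by
    ring_nf
  have hn (x : ℝ) : Complex.exp (u * Complex.I * (-x : ℝ)) =
      Complex.exp (-(u * Complex.I) * x) := by
    push_cast; ring_nf
  simp_rw [charFun_apply_real, hc]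
  rw [integral_asymLaplace hα hβ h1 (by simpa only [hn] using h2)]
  simp_rw [hn]
  rw [integral_cexp_expMeasure hα (by simpa using hα),
    integral_cexp_expMeasure hβ (by simpa using hβ)]
  have n1 : (α : ℂ) - u * Complex.I ≠ 0 := by
    intro h; have := congrArg Complex.re h; simp at this; linarith
  have n2 : (β : ℂ) - -(u * Complex.I) ≠ 0 := by
    intro h; have := congrArg Complex.re h; simp at this; linarith
  have n3 : (α : ℂ) + β ≠ 0 := by
    intro h; have := congrArg Complex.re h; simp at this; linarith
  have n4 : (α : ℂ) * β - u ^ 2 * Complex.I ^ 2 - (β - α) * (u * Complex.I) =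
      (α - u * Complex.I) * (β - -(u * Complex.I)) := by ring
  rw [n4]
  simp only [Complex.real_smul]
  push_cast
  field_simp
  ring

/-- Brownian motion with drift `δ` and volatility `σ`, run for an independent exponential time of
rate `r`, has an asymmetric Laplace law: its rates are, up to sign, the roots of the quadratic
`σ² s² / 2 + δ s - r`. -/
lemma map_exp_prod_gaussian {r δ σ α β : ℝ} (hr : 0 < r) (hσ : 0 < σ) (hα : 0 < α) (hβ : 0 < β)
    (hmul : α * β = 2 * r / σ ^ 2) (hsub : β - α = 2 * δ / σ ^ 2) :
    ((expMeasure r).prod (gaussianReal 0 1)).map (fun p ↦ δ * p.1 + σ * (√p.1 * p.2)) =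
      asymLaplace α β := by
  have := isProbabilityMeasure_expMeasure hr
  have := isProbabilityMeasure_asymLaplace hα hβ
  have hm : Measurable (fun p : ℝ × ℝ ↦ δ * p.1 + σ * (√p.1 * p.2)) := by fun_prop
  have := Measure.isProbabilityMeasure_map (μ := (expMeasure r).prod (gaussianReal 0 1))
    hm.aemeasurable
  refine Measure.ext_of_charFun (funext fun u ↦ ?_)
  rw [charFun_asymLaplace hα hβ, charFun_apply_real,
    integral_map hm.aemeasurable (by fun_prop), integral_prod]
  swap
  · refine Integrable.of_bound (by fun_prop) 1 (ae_of_all _ fun x ↦ ?_)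
    rw [← Complex.ofReal_mul, Complex.norm_exp_ofReal_mul_I]
  set w : ℂ := u * Complex.I * δ + σ ^ 2 * (u ^ 2 * Complex.I ^ 2) / 2 with hw
  have hin : ∀ᵐ t ∂expMeasure r, ∫ x : ℝ, Complex.exp (u * (δ * t + σ * (√t * x) : ℝ) * Complex.I)
      ∂gaussianReal 0 1 = Complex.exp (w * t) := by
    filter_upwards [ae_nonneg_expMeasure r] with t ht
    have h (x : ℝ) : Complex.exp (u * (δ * t + σ * (√t * x) : ℝ) * Complex.I) =
        Complex.exp (u * δ * t * Complex.I) *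
          Complex.exp ((u * σ * √t : ℝ) * x * Complex.I) := by
      rw [← Complex.exp_add]; push_cast; ring_nf
    simp_rw [h]
    rw [integral_const_mul, ← charFun_apply_real, charFun_gaussianReal, ← Complex.exp_add]
    congr 1
    have hs : ((√t : ℝ) : ℂ) ^ 2 = t := by
      rw [← Complex.ofReal_pow, Real.sq_sqrt ht]
    simp only [hw, Complex.I_sq]
    push_cast
    rw [mul_pow, hs]
    ring
  rw [integral_congr_ae hin, integral_cexp_expMeasure hr]
  · have hσ' : (σ : ℂ) ≠ 0 := by exact_mod_cast hσ.ne'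
    have e1 : (α : ℂ) * β = 2 * r / σ ^ 2 := by exact_mod_cast hmul
    have e2 : (β : ℂ) - α = 2 * δ / σ ^ 2 := by exact_mod_cast hsub
    rw [e1, e2]
    have : (2 * r / σ ^ 2 - u ^ 2 * Complex.I ^ 2 - 2 * δ / σ ^ 2 * (u * Complex.I) : ℂ) =
        2 / σ ^ 2 * (r - w) := by
      rw [hw]; field_simp; ring
    rw [this, mul_div_right_comm, mul_div_mul_left _ _ (by simp [hσ'])]
  · have hw' : w = ((-(σ ^ 2 * u ^ 2 / 2) : ℝ) : ℂ) + ((u * δ : ℝ) : ℂ) * Complex.I := by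
      rw [hw, Complex.I_sq]; push_cast; ring
    rw [hw', Complex.add_re, Complex.ofReal_re, Complex.re_ofReal_mul, Complex.I_re]
    have : 0 ≤ σ ^ 2 * u ^ 2 / 2 := by positivity
    linarith

/-! ### One-step equations for the loss and the time -/

/-- The expected relative loss as a function of the current log mispricing
`y`: the realised loss `1 - exp y` if the order is filled at `y ≤ 0`, and the expected loss
`1 / (1 + α)` of an exponential undershoot of rate `α` if the order is still alive. -/
noncomputable def lossFn (α y : ℝ) : ℝ := if y ≤ 0 then 1 - Real.exp y else 1 / (1 + α)

/-- Up to the drift, the expected remaining time: nothing once the order is filled at `y ≤ 0`, and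
the distance `y` to the boundary plus the mean undershoot `1 / α` while it is alive. -/
noncomputable def timeFn (α y : ℝ) : ℝ := if y ≤ 0 then 0 else y + 1 / α

lemma lossFn_of_nonpos {α y : ℝ} (hy : y ≤ 0) : lossFn α y = 1 - Real.exp y := if_pos hy

lemma lossFn_of_pos {α y : ℝ} (hy : 0 < y) : lossFn α y = 1 / (1 + α) := if_neg hy.not_ge

lemma timeFn_of_nonpos {α y : ℝ} (hy : y ≤ 0) : timeFn α y = 0 := if_pos hy

lemma timeFn_of_pos {α y : ℝ} (hy : 0 < y) : timeFn α y = y + 1 / α := if_neg hy.not_ge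

lemma measurable_lossFn (α : ℝ) : Measurable (lossFn α) :=
  Measurable.ite measurableSet_Iic (by fun_prop) (by fun_prop)

lemma measurable_timeFn (α : ℝ) : Measurable (timeFn α) :=
  Measurable.ite measurableSet_Iic (by fun_prop) (by fun_prop)

lemma abs_lossFn_le {α : ℝ} (hα : 0 < α) (y : ℝ) : |lossFn α y| ≤ 1 := by
  rcases le_or_gt y 0 with hy | hy
  · rw [lossFn_of_nonpos hy, abs_le]
    have := Real.exp_pos y
    have := Real.exp_le_one_iff.2 hy
    constructor <;> linarith
  · rw [lossFn_of_pos hy, abs_of_pos (by positivity), div_le_one (by positivity)]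
    linarith

lemma timeFn_nonneg {α : ℝ} (hα : 0 < α) (y : ℝ) : 0 ≤ timeFn α y := by
  rcases le_or_gt y 0 with hy | hy
  · rw [timeFn_of_nonpos hy]
  · rw [timeFn_of_pos hy]; positivity

lemma timeFn_le_abs {α : ℝ} (hα : 0 < α) (y : ℝ) : timeFn α y ≤ |y| + 1 / α := by
  rcases le_or_gt y 0 with hy | hy
  · rw [timeFn_of_nonpos hy]; positivity
  · rw [timeFn_of_pos hy, abs_of_pos hy]

lemma integrable_lossFn {α : ℝ} (hα : 0 < α) {Ω : Type*} [MeasurableSpace Ω] {μ : Measure Ω}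
    [IsFiniteMeasure μ] {f : Ω → ℝ}
    (hf : Measurable f) : Integrable (fun x ↦ lossFn α (f x)) μ :=
  Integrable.of_bound ((measurable_lossFn α).comp hf).aestronglyMeasurable 1
    (ae_of_all _ fun _ ↦ abs_lossFn_le hα _)

lemma integrable_timeFn {α : ℝ} (hα : 0 < α) {Ω : Type*} [MeasurableSpace Ω] {μ : Measure Ω}
    [IsFiniteMeasure μ] {f : Ω → ℝ}
    (hf : Measurable f) (hi : Integrable f μ) : Integrable (fun x ↦ timeFn α (f x)) μ := by
  refine (hi.abs.add (integrable_const (1 / α))).mono'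
    ((measurable_timeFn α).comp hf).aestronglyMeasurable (ae_of_all _ fun x ↦ ?_)
  rw [Real.norm_of_nonneg (timeFn_nonneg hα _)]
  exact timeFn_le_abs hα _

lemma hasDerivAt_exp_neg_mul (r x : ℝ) :
    HasDerivAt (fun x ↦ Real.exp (-(r * x))) (-(r * Real.exp (-(r * x)))) x := by
  refine ((hasDerivAt_id x).const_mul r).fun_neg.exp.congr_deriv ?_
  simp only [id_eq, mul_one]
  ring

/-- The constant `1 / (1 + α)` solves the one-step equation for the loss from every nonnegative
level. -/
lemma integral_lossFn_of_nonneg {α β z : ℝ} (hα : 0 < α) (hβ : 0 < β) (hz : 0 ≤ z) :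
    ∫ x, lossFn α (z - x) ∂asymLaplace α β = 1 / (1 + α) := by
  have := isProbabilityMeasure_expMeasure hα
  have := isProbabilityMeasure_expMeasure hβ
  rw [integral_asymLaplace hα hβ (integrable_lossFn hα (by fun_prop))
    (integrable_lossFn hα (by fun_prop))]
  have h1 : ∫ x, lossFn α (z - x) ∂expMeasure α = 1 / (1 + α) := by
    rw [integral_expMeasure_split hα hz (integrable_lossFn hα (by fun_prop))
      (F := fun x ↦ -(1 / (1 + α)) * Real.exp (-(α * x))) (by fun_prop)]
    · have h : ∀ᵐ x ∂expMeasure α, lossFn α (z - (z + x)) = 1 - Real.exp (-1 * x) := by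
        filter_upwards [ae_nonneg_expMeasure α] with x hx
        rw [lossFn_of_nonpos (by linarith)]
        ring_nf
      rw [integral_congr_ae h, integral_sub (integrable_const _)
        (integrable_exp_expMeasure hα (by linarith)),
        integral_exp_expMeasure hα (by linarith)]
      simp only [integral_const, probReal_univ, smul_eq_mul, mul_one, mul_zero, neg_zero,
        Real.exp_zero]
      have : α - -1 ≠ 0 := by linarith
      have : 1 + α ≠ 0 := by linarith
      field_simp
      ring
    · intro x hx
      rw [lossFn_of_pos (by linarith [hx.2])]
      refine ((hasDerivAt_exp_neg_mul α x).const_mul (-(1 / (1 + α)))).congr_deriv ?_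
      ring
  have h2 : ∫ x, lossFn α (z - -x) ∂expMeasure β = 1 / (1 + α) := by
    have h : ∀ᵐ x ∂expMeasure β, lossFn α (z - -x) = 1 / (1 + α) := by
      filter_upwards [ae_pos_expMeasure β] with x hx
      rw [lossFn_of_pos (by linarith)]
    rw [integral_congr_ae h]
    simp
  rw [h1, h2, ← add_smul, ← add_div, add_comm β α, div_self (by positivity), one_smul]

lemma integral_lossFn_of_neg {α β z : ℝ} (hα : 0 < α) (hβ : 0 < β) (hβ1 : β ≠ 1) (hz : z < 0) :
    ∫ x, lossFn α (z - x) ∂asymLaplace α β =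
      1 - α * β / ((1 + α) * (β - 1)) * Real.exp z +
        α / ((1 + α) * (β - 1)) * Real.exp (β * z) := by
  have := isProbabilityMeasure_expMeasure hα
  have := isProbabilityMeasure_expMeasure hβ
  rw [integral_asymLaplace hα hβ (integrable_lossFn hα (by fun_prop))
    (integrable_lossFn hα (by fun_prop))]
  have hb : β - 1 ≠ 0 := sub_ne_zero.2 hβ1
  have ha : 1 + α ≠ 0 := by positivity
  have hab : α + β ≠ 0 := by positivity
  have h1 : ∫ x, lossFn α (z - x) ∂expMeasure α = 1 - α / (1 + α) * Real.exp z := by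
    have h : ∀ᵐ x ∂expMeasure α,
        lossFn α (z - x) = 1 - Real.exp z * Real.exp (-1 * x) := by
      filter_upwards [ae_nonneg_expMeasure α] with x hx
      rw [lossFn_of_nonpos (by linarith), ← Real.exp_add]
      ring_nf
    rw [integral_congr_ae h, integral_sub (integrable_const _)
      ((integrable_exp_expMeasure hα (by linarith)).const_mul _), integral_const_mul,
      integral_exp_expMeasure hα (by linarith)]
    simp only [integral_const, probReal_univ, smul_eq_mul, mul_one]
    rw [sub_neg_eq_add, add_comm α 1]
    ring
  have h2 : ∫ x, lossFn α (z - -x) ∂expMeasure β =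
      1 - β / (β - 1) * Real.exp z + (1 / (β - 1) + 1 / (1 + α)) * Real.exp (β * z) := by
    have he (x : ℝ) : Real.exp (-(β * x)) * Real.exp (z + x) =
        Real.exp z * Real.exp (-((β - 1) * x)) := by
      rw [← Real.exp_add, ← Real.exp_add]; ring_nf
    rw [integral_expMeasure_split hβ (z := -z) (by linarith)
      (integrable_lossFn hα (by fun_prop))
      (F := fun x ↦ -Real.exp (-(β * x)) +
        β / (β - 1) * Real.exp z * Real.exp (-((β - 1) * x))) (by fun_prop)]
    · have h : ∀ᵐ x ∂expMeasure β, lossFn α (z - -(-z + x)) = 1 / (1 + α) := by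
        filter_upwards [ae_pos_expMeasure β] with x hx
        rw [lossFn_of_pos (by linarith)]
      rw [integral_congr_ae h]
      simp only [integral_const, probReal_univ, smul_eq_mul, mul_zero, neg_zero,
        Real.exp_zero, mul_one, one_mul]
      have e1 : Real.exp (-(β * -z)) = Real.exp (β * z) := by ring_nf
      have e2 : β / (β - 1) * Real.exp z * Real.exp (-((β - 1) * -z)) =
          β / (β - 1) * Real.exp (β * z) := by
        rw [mul_assoc, ← Real.exp_add]; ring_nf
      rw [e1, e2]
      field_simp
      ring
    · intro x hx
      rw [lossFn_of_nonpos (by linarith [hx.2]), sub_neg_eq_add]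
      refine ((hasDerivAt_exp_neg_mul β x).fun_neg.fun_add
        ((hasDerivAt_exp_neg_mul (β - 1) x).const_mul
          (β / (β - 1) * Real.exp z))).congr_deriv ?_
      rw [mul_sub, mul_assoc β _ (Real.exp (z + x)), he]
      field_simp
      ring
  rw [h1, h2]
  simp only [smul_eq_mul]
  field_simp
  ring

/-- Averaging `timeFn` over one step from a nonnegative level replaces the mean undershoot `1 / α`
by the mean overshoot `1 / β` of an upward step. -/
lemma integral_timeFn_of_nonneg {α β z : ℝ} (hα : 0 < α) (hβ : 0 < β) (hz : 0 ≤ z) :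
    ∫ x, timeFn α (z - x) ∂asymLaplace α β = z + 1 / β := by
  have := isProbabilityMeasure_expMeasure hα
  have := isProbabilityMeasure_expMeasure hβ
  have i1 := integrable_timeFn hα (f := fun x ↦ z - x) (by fun_prop)
    ((integrable_const z).sub (integrable_id_expMeasure hα))
  have i2 := integrable_timeFn hα (f := fun x ↦ z - -x) (by fun_prop)
    ((integrable_const z).sub (integrable_id_expMeasure hβ).neg)
  rw [integral_asymLaplace hα hβ i1 i2]
  have h1 : ∫ x, timeFn α (z - x) ∂expMeasure α = z := by
    rw [integral_expMeasure_split hα hz i1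
      (F := fun x ↦ (x - z) * Real.exp (-(α * x))) (by fun_prop)]
    · have h : ∀ᵐ x ∂expMeasure α, timeFn α (z - (z + x)) = 0 := by
        filter_upwards [ae_nonneg_expMeasure α] with x hx
        exact timeFn_of_nonpos (by linarith)
      rw [integral_congr_ae h]
      simp
    · intro x hx
      rw [timeFn_of_pos (by linarith [hx.2])]
      refine (((hasDerivAt_id x).sub_const z).fun_mul
        (hasDerivAt_exp_neg_mul α x)).congr_deriv ?_
      simp only [id_eq]
      field_simp
      ring
  have h2 : ∫ x, timeFn α (z - -x) ∂expMeasure β = z + 1 / α + 1 / β := by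
    have h : ∀ᵐ x ∂expMeasure β, timeFn α (z - -x) = (z + 1 / α) + x := by
      filter_upwards [ae_pos_expMeasure β] with x hx
      rw [timeFn_of_pos (by linarith)]
      ring
    rw [integral_congr_ae h, integral_add (integrable_const _) (integrable_id_expMeasure hβ),
      integral_id_expMeasure hβ]
    simp
  rw [h1, h2]
  simp only [smul_eq_mul]
  field_simp
  ring

lemma integral_timeFn_of_neg {α β z : ℝ} (hα : 0 < α) (hβ : 0 < β) (hz : z < 0) :
    ∫ x, timeFn α (z - x) ∂asymLaplace α β = Real.exp (β * z) / β := by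
  have := isProbabilityMeasure_expMeasure hα
  have := isProbabilityMeasure_expMeasure hβ
  have i1 := integrable_timeFn hα (f := fun x ↦ z - x) (by fun_prop)
    ((integrable_const z).sub (integrable_id_expMeasure hα))
  have i2 := integrable_timeFn hα (f := fun x ↦ z - -x) (by fun_prop)
    ((integrable_const z).sub (integrable_id_expMeasure hβ).neg)
  rw [integral_asymLaplace hα hβ i1 i2]
  have h1 : ∫ x, timeFn α (z - x) ∂expMeasure α = 0 := by
    have h : ∀ᵐ x ∂expMeasure α, timeFn α (z - x) = 0 := by
      filter_upwards [ae_nonneg_expMeasure α] with x hx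
      exact timeFn_of_nonpos (by linarith)
    rw [integral_congr_ae h]
    simp
  have h2 : ∫ x, timeFn α (z - -x) ∂expMeasure β = Real.exp (β * z) * (1 / α + 1 / β) := by
    rw [integral_expMeasure_split hβ (z := -z) (by linarith) i2 (F := fun _ ↦ 0) (by fun_prop)]
    · have h : ∀ᵐ x ∂expMeasure β, timeFn α (z - -(-z + x)) = 1 / α + x := by
        filter_upwards [ae_pos_expMeasure β] with x hx
        rw [timeFn_of_pos (by linarith)]
        ring
      rw [integral_congr_ae h, integral_add (integrable_const _) (integrable_id_expMeasure hβ),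
        integral_id_expMeasure hβ]
      simp
    · intro x hx
      rw [timeFn_of_nonpos (by linarith [hx.2]), mul_zero]
      exact hasDerivAt_const _ _
  rw [h1, h2]
  simp only [smul_eq_mul]
  field_simp
  ring

lemma integrable_exp_mul_sub_asymLaplace {α β θ : ℝ} (hα : 0 < α) (hβ : 0 < β) (hθ : 0 < θ)
    (hθβ : θ < β) (z : ℝ) :
    Integrable (fun x ↦ Real.exp (θ * (z - x))) (asymLaplace α β) := by
  have h (x : ℝ) : Real.exp (θ * (z - x)) = Real.exp (θ * z) * Real.exp (-θ * x) := by
    rw [← Real.exp_add]; ring_nf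
  simp_rw [h]
  refine Integrable.const_mul (integrable_asymLaplace
    (integrable_exp_expMeasure hα (by linarith)) ?_) _
  simpa using integrable_exp_expMeasure hβ hθβ

lemma integral_exp_mul_sub_asymLaplace {α β θ : ℝ} (hα : 0 < α) (hβ : 0 < β) (hθ : 0 < θ)
    (hθβ : θ < β) (z : ℝ) :
    ∫ x, Real.exp (θ * (z - x)) ∂asymLaplace α β =
      α * β / ((α + θ) * (β - θ)) * Real.exp (θ * z) := by
  have h (x : ℝ) : Real.exp (θ * (z - x)) = Real.exp (θ * z) * Real.exp (-θ * x) := by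
    rw [← Real.exp_add]; ring_nf
  have hn (x : ℝ) : -θ * -x = θ * x := by ring
  simp_rw [h]
  rw [integral_const_mul, integral_asymLaplace hα hβ
    (integrable_exp_expMeasure hα (by linarith))
    (by simpa only [hn] using integrable_exp_expMeasure hβ hθβ)]
  simp_rw [hn]
  rw [integral_exp_expMeasure hα (by linarith), integral_exp_expMeasure hβ hθβ, sub_neg_eq_add]
  have : β - θ ≠ 0 := by linarith
  simp only [smul_eq_mul]
  field_simp
  ring

/-! ### Brownian motion sampled at independent renewal times -/

section BrownianSampling

/-- Evaluation of the path `w` at time `t` through its values at rational times. It is jointly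
measurable in `(w, t)` for the product σ-algebra on paths, unlike plain evaluation, and agrees with
plain evaluation when `w` is continuous. -/
noncomputable def pathEval (w : ℝ≥0 → ℝ) (t : ℝ≥0) : ℝ :=
  limsup (fun n : ℕ ↦ w ((⌈(t : ℝ) * n⌉₊ : ℝ≥0) / n)) atTop

lemma measurable_pathEval : Measurable (fun p : (ℝ≥0 → ℝ) × ℝ≥0 ↦ pathEval p.1 p.2) := by
  refine Measurable.limsup fun n ↦ ?_
  have h1 : Measurable (fun p : (ℝ≥0 → ℝ) × ℕ ↦ p.1 ((p.2 : ℝ≥0) / n)) :=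
    measurable_from_prod_countable_left fun k ↦
      measurable_pi_apply ((k : ℝ≥0) / n)
  have h2 : Measurable (fun p : (ℝ≥0 → ℝ) × ℝ≥0 ↦ (p.1, ⌈(p.2 : ℝ) * n⌉₊)) :=
    measurable_fst.prodMk (Nat.measurable_ceil.comp (by fun_prop))
  exact h1.comp h2

lemma pathEval_of_continuous {w : ℝ≥0 → ℝ} (hw : Continuous w) (t : ℝ≥0) :
    pathEval w t = w t := by
  refine Tendsto.limsup_eq ((hw.tendsto t).comp ?_)
  rw [← NNReal.tendsto_coe]
  have := (tendsto_nat_ceil_mul_div_atTop (R := ℝ) t.2).comp tendsto_natCast_atTop_atTop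
  exact this.congr fun n ↦ by simp

/-- The arrival times with waiting times `g`, starting from time `0` at index `0`. -/
noncomputable def arrival (g : ℕ → ℝ≥0) (n : ℕ) : ℝ≥0 := ∑ i ∈ Finset.range n, g i

/-- The increment of `δ t + σ w t` between the `n`-th and the `(n + 1)`-st arrival. -/
noncomputable def driftStep (δ σ : ℝ) (w : ℝ≥0 → ℝ) (g : ℕ → ℝ≥0) (n : ℕ) : ℝ :=
  δ * g n + σ * (pathEval w (arrival g (n + 1)) - pathEval w (arrival g n))

lemma measurable_arrival (n : ℕ) : Measurable (fun g ↦ arrival g n) :=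
  Finset.measurable_sum _ fun i _ ↦ measurable_pi_apply i

lemma measurable_driftStep (δ σ : ℝ) (n : ℕ) :
    Measurable (fun p : (ℝ≥0 → ℝ) × (ℕ → ℝ≥0) ↦ driftStep δ σ p.1 p.2 n) := by
  have h (m : ℕ) : Measurable
      (fun p : (ℝ≥0 → ℝ) × (ℕ → ℝ≥0) ↦ pathEval p.1 (arrival p.2 m)) := by
    have ha : Measurable (fun p : (ℝ≥0 → ℝ) × (ℕ → ℝ≥0) ↦ (p.1, arrival p.2 m)) :=
      measurable_fst.prodMk ((measurable_arrival m).comp measurable_snd)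
    have hc := measurable_pathEval.comp ha
    simp only [Function.comp_def] at hc
    exact hc
  have hg : Measurable (fun p : (ℝ≥0 → ℝ) × (ℕ → ℝ≥0) ↦ (p.2 n : ℝ)) :=
    measurable_coe_nnreal_real.comp ((measurable_pi_apply n).comp measurable_snd)
  simp only [driftStep]
  exact (hg.const_mul δ).add (((h _).sub (h _)).const_mul σ)

lemma monotone_arrival (g : ℕ → ℝ≥0) : Monotone (arrival g) :=
  monotone_nat_of_le_succ fun n ↦ by
    rw [arrival, arrival, Finset.sum_range_succ]; exact le_self_add

lemma sum_driftStep (δ σ : ℝ) (w : ℝ≥0 → ℝ) (g : ℕ → ℝ≥0) (n : ℕ) :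
    ∑ i ∈ Finset.range n, driftStep δ σ w g i =
      δ * arrival g n + σ * (pathEval w (arrival g n) - pathEval w 0) := by
  have h0 : arrival g 0 = 0 := by simp [arrival]
  simp_rw [driftStep]
  rw [Finset.sum_add_distrib, ← Finset.mul_sum, ← Finset.mul_sum,
    Finset.sum_range_sub (fun i ↦ pathEval w (arrival g i)), h0, arrival, NNReal.coe_sum]

variable {Ω : Type*} [MeasurableSpace Ω] {P : Measure Ω}

/-- Along a deterministic sequence of times, the steps are independent Gaussian variables. -/
lemma iIndepFun_driftStep_const {W : ℝ≥0 → Ω → ℝ} (hW : IsBrownianReal W P) (δ σ : ℝ)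
    (g : ℕ → ℝ≥0) :
    iIndepFun (fun n ω ↦ driftStep δ σ (fun t ↦ W t ω) g n) P := by
  have h := hW.toIsPreBrownianReal.hasIndepIncrements.nat (monotone_arrival g)
  have h' := h.comp (fun n x ↦ δ * g n + σ * x) (fun n ↦ by fun_prop)
  refine (iIndepFun_congr fun n ↦ ?_).1 h'
  filter_upwards [hW.cont] with ω hω
  simp only [Function.comp, driftStep, pathEval_of_continuous hω]

lemma map_driftStep_const {W : ℝ≥0 → Ω → ℝ} (hW : IsBrownianReal W P) (δ σ : ℝ)
    (g : ℕ → ℝ≥0) (n : ℕ) :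
    P.map (fun ω ↦ driftStep δ σ (fun t ↦ W t ω) g n) =
      (gaussianReal 0 1).map (fun x ↦ δ * g n + σ * (√(g n : ℝ) * x)) := by
  have h := hW.toIsPreBrownianReal.hasLaw_sub (arrival g (n + 1)) (arrival g n)
  have hd : nndist (arrival g (n + 1)).1 (arrival g n).1 = g n := by
    rw [NNReal.coe_inj.symm, coe_nndist, Real.dist_eq]
    have : (arrival g (n + 1)).1 = (arrival g n).1 + g n := by
      rw [arrival, Finset.sum_range_succ]; rfl
    rw [this, add_sub_cancel_left]
    exact abs_of_nonneg (g n).2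
  rw [hd] at h
  have hae : (fun ω ↦ driftStep δ σ (fun t ↦ W t ω) g n) =ᵐ[P]
      (fun x ↦ δ * g n + σ * x) ∘ (W (arrival g (n + 1)) - W (arrival g n)) := by
    filter_upwards [hW.cont] with ω hω
    simp only [Function.comp, driftStep, pathEval_of_continuous hω, Pi.sub_apply]
  have hs : (gaussianReal 0 1).map (fun x ↦ √(g n : ℝ) * x) = gaussianReal 0 (g n) := by
    rw [gaussianReal_map_const_mul]
    congr 1
    · simp
    · ext; simp
  rw [Measure.map_congr hae, ← AEMeasurable.map_map_of_aemeasurable (by fun_prop) h.aemeasurable,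
    h.map_eq, ← hs, Measure.map_map (by fun_prop) (by fun_prop)]
  rfl

/-- Joint law of a waiting time with law `ν` and of the increment of `δ t + σ W t` over it. -/
noncomputable def stepLaw (ν : Measure ℝ≥0) (δ σ : ℝ) : Measure (ℝ≥0 × ℝ) :=
  (ν.prod (gaussianReal 0 1)).map (fun p ↦ (p.1, δ * p.1 + σ * (√(p.1 : ℝ) * p.2)))

lemma stepLaw_apply (ν : Measure ℝ≥0) [SFinite ν] (δ σ : ℝ) {C : Set (ℝ≥0 × ℝ)}
    (hC : MeasurableSet C) :
    stepLaw ν δ σ C = ∫⁻ t, (gaussianReal 0 1).map (fun x ↦ δ * t + σ * (√(t : ℝ) * x))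
      (Prod.mk t ⁻¹' C) ∂ν := by
  rw [stepLaw, Measure.map_apply (by fun_prop) hC, Measure.prod_apply]
  · refine lintegral_congr fun t ↦ ?_
    rw [Measure.map_apply (by fun_prop) (measurable_prodMk_left hC)]
    rfl
  · exact (by fun_prop : Measurable
      (fun p : ℝ≥0 × ℝ ↦ (p.1, δ * (p.1 : ℝ) + σ * (√(p.1 : ℝ) * p.2)))) hC

lemma measurable_stepLaw_section (δ σ : ℝ) {C : Set (ℝ≥0 × ℝ)} (hC : MeasurableSet C) :
    Measurable (fun t : ℝ≥0 ↦ (gaussianReal 0 1).map (fun x ↦ δ * t + σ * (√(t : ℝ) * x))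
      (Prod.mk t ⁻¹' C)) := by
  have hm : Measurable (fun p : ℝ≥0 × ℝ ↦ (p.1, δ * (p.1 : ℝ) + σ * (√(p.1 : ℝ) * p.2))) := by
    fun_prop
  have := measurable_measure_prodMk_left (ν := gaussianReal 0 1) (hm hC)
  convert this using 2 with t
  rw [Measure.map_apply (by fun_prop) (measurable_prodMk_left hC)]
  rfl

section

variable [IsProbabilityMeasure P] {W : ℝ≥0 → Ω → ℝ} {gap : ℕ → Ω → ℝ≥0} {ν : Measure ℝ≥0}

/-- Conditioning on the waiting times, which are independent of the Brownian motion, turns the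
joint law of the steps into a product. -/
lemma measure_iInter_driftStep (hWmeas : ∀ t, Measurable (W t)) (hW : IsBrownianReal W P)
    (hgm : ∀ n, Measurable (gap n)) (hgi : iIndepFun gap P) (hν : ∀ n, P.map (gap n) = ν)
    (hindep : IndepFun (fun ω t ↦ W t ω) (fun ω n ↦ gap n ω) P) (δ σ : ℝ)
    (S : Finset ℕ) {C : ℕ → Set (ℝ≥0 × ℝ)} (hC : ∀ i ∈ S, MeasurableSet (C i)) :
    P (⋂ i ∈ S, (fun ω ↦ (gap i ω, driftStep δ σ (fun t ↦ W t ω) (fun n ↦ gap n ω) i)) ⁻¹' C i) =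
      ∏ i ∈ S, stepLaw ν δ σ (C i) := by
  have hWp : Measurable (fun ω t ↦ W t ω) := measurable_pi_lambda _ hWmeas
  have hgp : Measurable (fun ω n ↦ gap n ω) := measurable_pi_lambda _ hgm
  have : IsProbabilityMeasure ν := hν 0 ▸ Measure.isProbabilityMeasure_map (hgm 0).aemeasurable
  have := Measure.isProbabilityMeasure_map (μ := P) hWp.aemeasurable
  have := Measure.isProbabilityMeasure_map (μ := P) hgp.aemeasurable
  have hprod := (indepFun_iff_map_prod_eq_prod_map_map hWp.aemeasurable hgp.aemeasurable).1 hindep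
  set B : Set ((ℝ≥0 → ℝ) × (ℕ → ℝ≥0)) :=
    ⋂ i ∈ S, (fun p ↦ (p.2 i, driftStep δ σ p.1 p.2 i)) ⁻¹' C i with hB
  have hBm : MeasurableSet B := Finset.measurableSet_biInter _ fun i hi ↦
    (((measurable_pi_apply i).comp measurable_snd).prodMk (measurable_driftStep δ σ i)) (hC i hi)
  have h1 : (⋂ i ∈ S,
      (fun ω ↦ (gap i ω, driftStep δ σ (fun t ↦ W t ω) (fun n ↦ gap n ω) i)) ⁻¹' C i) =
      (fun ω ↦ ((fun t ↦ W t ω), (fun n ↦ gap n ω))) ⁻¹' B := by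
    simp only [hB, preimage_iInter]; rfl
  rw [h1, ← Measure.map_apply (hWp.prodMk hgp) hBm, hprod, Measure.prod_apply_symm hBm]
  have h2 (g : ℕ → ℝ≥0) : P.map (fun ω t ↦ W t ω) ((fun w ↦ (w, g)) ⁻¹' B) =
      ∏ i ∈ S, (gaussianReal 0 1).map (fun x ↦ δ * g i + σ * (√(g i : ℝ) * x))
        (Prod.mk (g i) ⁻¹' C i) := by
    have hm (i : ℕ) : Measurable (fun ω ↦ driftStep δ σ (fun t ↦ W t ω) g i) :=
      (measurable_driftStep δ σ i).comp (hWp.prodMk measurable_const)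
    rw [Measure.map_apply hWp (measurable_prodMk_right hBm)]
    have := (iIndepFun_driftStep_const hW δ σ g).measure_inter_preimage_eq_mul S
      (sets := fun i ↦ Prod.mk (g i) ⁻¹' C i) (fun i hi ↦ measurable_prodMk_left (hC i hi))
    simp only [hB, preimage_iInter]
    refine this.trans (Finset.prod_congr rfl fun i hi ↦ ?_)
    rw [← map_driftStep_const hW, Measure.map_apply (hm i) (measurable_prodMk_left (hC i hi))]
  simp_rw [h2]
  set f : ℕ → ℝ≥0 → ENNReal := fun i t ↦ if i ∈ S then
    (gaussianReal 0 1).map (fun x ↦ δ * t + σ * (√(t : ℝ) * x)) (Prod.mk t ⁻¹' C i) else 0 with hf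
  have hfm (i : ℕ) : Measurable (f i) := by
    by_cases hi : i ∈ S
    · simp only [hf, hi, if_true]; exact measurable_stepLaw_section δ σ (hC i hi)
    · simp only [hf, hi, if_false]; exact measurable_const
  have h3 (g : ℕ → ℝ≥0) : ∏ i ∈ S, (gaussianReal 0 1).map
      (fun x ↦ δ * g i + σ * (√(g i : ℝ) * x)) (Prod.mk (g i) ⁻¹' C i) = ∏ i ∈ S, f i (g i) :=
    Finset.prod_congr rfl fun i hi ↦ by simp only [hf, hi, if_true]
  simp_rw [h3]
  have hpm : Measurable (fun g : ℕ → ℝ≥0 ↦ ∏ i ∈ S, f i (g i)) :=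
    Finset.measurable_prod _ fun i _ ↦ (hfm i).comp (measurable_pi_apply i)
  rw [lintegral_map hpm hgp]
  have h4 := lintegral_prod_eq_prod_lintegral_of_indepFun S (fun i ω ↦ f i (gap i ω))
    (hgi.comp f hfm) (fun i ↦ (hfm i).comp (hgm i))
  rw [h4]
  refine Finset.prod_congr rfl fun i hi ↦ ?_
  rw [stepLaw_apply ν δ σ (hC i hi), ← lintegral_map (hfm i) (hgm i), hν i]
  simp only [hf, hi, if_true]

lemma measurable_gap_driftStep (hWmeas : ∀ t, Measurable (W t)) (hgm : ∀ n, Measurable (gap n))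
    (δ σ : ℝ) (i : ℕ) :
    Measurable (fun ω ↦ (gap i ω, driftStep δ σ (fun t ↦ W t ω) (fun n ↦ gap n ω) i)) :=
  (hgm i).prodMk ((measurable_driftStep δ σ i).comp
    ((measurable_pi_lambda _ hWmeas).prodMk (measurable_pi_lambda _ hgm)))

lemma map_gap_driftStep (hWmeas : ∀ t, Measurable (W t)) (hW : IsBrownianReal W P)
    (hgm : ∀ n, Measurable (gap n)) (hgi : iIndepFun gap P) (hν : ∀ n, P.map (gap n) = ν)
    (hindep : IndepFun (fun ω t ↦ W t ω) (fun ω n ↦ gap n ω) P) (δ σ : ℝ) (i : ℕ) :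
    P.map (fun ω ↦ (gap i ω, driftStep δ σ (fun t ↦ W t ω) (fun n ↦ gap n ω) i)) =
      stepLaw ν δ σ := by
  ext C hC
  rw [Measure.map_apply (measurable_gap_driftStep hWmeas hgm δ σ i) hC]
  simpa using measure_iInter_driftStep hWmeas hW hgm hgi hν hindep δ σ {i} (C := fun _ ↦ C)
    (fun _ _ ↦ hC)

/-- The pairs of a waiting time and the increment of `δ t + σ W t` over it are independent. -/
lemma iIndepFun_gap_driftStep (hWmeas : ∀ t, Measurable (W t)) (hW : IsBrownianReal W P)
    (hgm : ∀ n, Measurable (gap n)) (hgi : iIndepFun gap P) (hν : ∀ n, P.map (gap n) = ν)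
    (hindep : IndepFun (fun ω t ↦ W t ω) (fun ω n ↦ gap n ω) P) (δ σ : ℝ) :
    iIndepFun (fun i ω ↦ (gap i ω, driftStep δ σ (fun t ↦ W t ω) (fun n ↦ gap n ω) i)) P := by
  rw [iIndepFun_iff_measure_inter_preimage_eq_mul]
  intro S C hC
  rw [measure_iInter_driftStep hWmeas hW hgm hgi hν hindep δ σ S hC]
  refine Finset.prod_congr rfl fun i hi ↦ ?_
  rw [← map_gap_driftStep hWmeas hW hgm hgi hν hindep δ σ i,
    Measure.map_apply (measurable_gap_driftStep hWmeas hgm δ σ i) (hC i hi)]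

end

/-- Over an exponential waiting time of rate `r`, the increment of `δ t + σ W t` has an asymmetric
Laplace law. -/
lemma map_snd_stepLaw {ν : Measure ℝ≥0} [SFinite ν] {r δ σ α β : ℝ}
    (hν : ν.map (fun t : ℝ≥0 ↦ (t : ℝ)) = expMeasure r) (hr : 0 < r) (hσ : 0 < σ) (hα : 0 < α)
    (hβ : 0 < β) (hmul : α * β = 2 * r / σ ^ 2) (hsub : β - α = 2 * δ / σ ^ 2) :
    (stepLaw ν δ σ).map Prod.snd = asymLaplace α β := by
  rw [← map_exp_prod_gaussian hr hσ hα hβ hmul hsub, stepLaw,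
    Measure.map_map (by fun_prop) (by fun_prop), ← hν]
  have h := Measure.map_prod_map ν (gaussianReal 0 1) (f := fun t : ℝ≥0 ↦ (t : ℝ)) (g := id)
    (by fun_prop) (by fun_prop)
  rw [Measure.map_id] at h
  rw [h, Measure.map_map (by fun_prop) (by fun_prop)]
  rfl

end BrownianSampling

/-! ### Random walks and their first exit from the positive half-line -/

section Walk

variable {Ω : Type*}

/-- The random walk started at `z` that decreases by `X i` in its `i`-th step. -/
noncomputable def walk (z : ℝ) (X : ℕ → Ω → ℝ) (n : ℕ) (ω : Ω) : ℝ :=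
  z - ∑ i ∈ Finset.range n, X i ω

/-- The event that the order is still unfilled after `n` blocks: `S` is positive at the times
`1, …, n`. The starting value `S 0` is not looked at. -/
def aliveSet (S : ℕ → Ω → ℝ) (n : ℕ) : Set Ω := {ω | ∀ k < n, 0 < S (k + 1) ω}

/-- The index of the first nonpositive term of `S 1, S 2, …`, counted from `0`; it is `0` if there
is no such term. -/
noncomputable def exitIndex (S : ℕ → Ω → ℝ) (ω : Ω) : ℕ := sInf {n | S (n + 1) ω ≤ 0}

lemma walk_succ (z : ℝ) (X : ℕ → Ω → ℝ) (n : ℕ) (ω : Ω) :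
    walk z X (n + 1) ω = walk z X n ω - X n ω := by
  rw [walk, walk, Finset.sum_range_succ]; ring

lemma aliveSet_zero (S : ℕ → Ω → ℝ) : aliveSet S 0 = univ := by simp [aliveSet]

lemma mem_aliveSet_succ {S : ℕ → Ω → ℝ} {n : ℕ} {ω : Ω} :
    ω ∈ aliveSet S (n + 1) ↔ ω ∈ aliveSet S n ∧ 0 < S (n + 1) ω := by
  simp only [aliveSet, mem_ofPred_eq, Nat.lt_succ_iff_lt_or_eq]
  exact ⟨fun h ↦ ⟨fun k hk ↦ h k (Or.inl hk), h n (Or.inr rfl)⟩,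
    fun h k hk ↦ hk.elim (h.1 k) (fun e ↦ e ▸ h.2)⟩

lemma aliveSet_succ_subset (S : ℕ → Ω → ℝ) (n : ℕ) : aliveSet S (n + 1) ⊆ aliveSet S n :=
  fun _ h ↦ (mem_aliveSet_succ.1 h).1

lemma exitIndex_eq_of_mem {S : ℕ → Ω → ℝ} {n : ℕ} {ω : Ω} (h : ω ∈ aliveSet S n)
    (h' : S (n + 1) ω ≤ 0) : exitIndex S ω = n := by
  refine le_antisymm (Nat.sInf_le h') (le_csInf ⟨n, h'⟩ fun k hk ↦ ?_)
  by_contra! hlt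
  exact absurd (h k hlt) (not_lt.2 hk)

lemma exitIndex_spec {S : ℕ → Ω → ℝ} {ω : Ω} (h : ∃ n, S (n + 1) ω ≤ 0) :
    S (exitIndex S ω + 1) ω ≤ 0 := Nat.sInf_mem (s := {n | S (n + 1) ω ≤ 0}) h

lemma mem_aliveSet_iff_le_exitIndex {S : ℕ → Ω → ℝ} {ω : Ω} (h : ∃ n, S (n + 1) ω ≤ 0) (n : ℕ) :
    ω ∈ aliveSet S n ↔ n ≤ exitIndex S ω := by
  refine ⟨fun hn ↦ ?_, fun hn k hk ↦ ?_⟩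
  · by_contra! hlt
    exact absurd (hn _ hlt) (not_lt.2 (exitIndex_spec h))
  · exact not_le.1 (Nat.notMem_of_lt_sInf (s := {n | S (n + 1) ω ≤ 0}) (hk.trans_le hn))

lemma walk_eq_past {X : ℕ → Ω → ℝ} (z : ℝ) {m n : ℕ} (hmn : m ≤ n) (ω : Ω) :
    walk z X m ω = walk z (fun i (x : ℕ → ℝ) ↦ x i) m (fun i ↦ if i < n then X i ω else 0) := by
  rw [walk, walk]
  congr 1
  refine Finset.sum_congr rfl fun i hi ↦ ?_
  exact (if_pos ((Finset.mem_range.1 hi).trans_le hmn)).symm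

lemma mem_aliveSet_walk_iff_past {X : ℕ → Ω → ℝ} (z : ℝ) (n : ℕ) (ω : Ω) :
    ω ∈ aliveSet (walk z X) n ↔ (fun i ↦ if i < n then X i ω else 0) ∈
      aliveSet (walk z (fun i (x : ℕ → ℝ) ↦ x i)) n := by
  refine forall₂_congr fun k hk ↦ ?_
  rw [walk_eq_past z hk]

variable [MeasurableSpace Ω]

lemma measurable_walk {X : ℕ → Ω → ℝ} (hX : ∀ n, Measurable (X n)) (z : ℝ) (n : ℕ) :
    Measurable (walk z X n) :=
  measurable_const.sub (Finset.measurable_sum _ fun i _ ↦ hX i)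

lemma measurableSet_aliveSet {S : ℕ → Ω → ℝ} (hS : ∀ n, Measurable (S n)) (n : ℕ) :
    MeasurableSet (aliveSet S n) := by
  have : aliveSet S n = ⋂ k ∈ Finset.range n, {ω | 0 < S (k + 1) ω} := by
    ext; simp [aliveSet]
  rw [this]
  exact Finset.measurableSet_biInter _ fun k _ ↦ measurableSet_lt measurable_const (hS _)

lemma measurable_exitIndex {S : ℕ → Ω → ℝ} (hS : ∀ n, Measurable (S n)) :
    Measurable (exitIndex S) := by
  refine measurable_to_nat fun ω ↦ ?_
  set k := exitIndex S ω
  have hD : MeasurableSet {ω' | ω' ∈ aliveSet S k ∧ S (k + 1) ω' ≤ 0} :=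
    (measurableSet_aliveSet hS k).inter (measurableSet_le (hS _) measurable_const)
  have hN : MeasurableSet {ω' | k = 0 ∧ ∀ n, 0 < S (n + 1) ω'} := by
    have h : MeasurableSet {ω' | ∀ n, 0 < S (n + 1) ω'} := by
      rw [ofPred_forall]
      exact MeasurableSet.iInter fun n ↦ measurableSet_lt measurable_const (hS _)
    exact (MeasurableSet.const (k = 0)).inter h
  convert hD.union hN using 1
  ext ω'
  simp only [mem_preimage, mem_singleton_iff, mem_union, mem_ofPred_eq]
  constructor
  · intro h
    by_cases he : ∃ n, S (n + 1) ω' ≤ 0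
    · left
      rw [← h]
      exact ⟨(mem_aliveSet_iff_le_exitIndex he _).2 le_rfl, exitIndex_spec he⟩
    · right
      push Not at he
      refine ⟨?_, he⟩
      rw [← h, exitIndex]
      have : {n | S (n + 1) ω' ≤ 0} = ∅ := by
        ext n; simpa using he n
      rw [this, Nat.sInf_empty]
  · rintro (⟨h1, h2⟩ | ⟨h1, h2⟩)
    · exact exitIndex_eq_of_mem h1 h2
    · rw [h1, exitIndex]
      have : {n | S (n + 1) ω' ≤ 0} = ∅ := by
        ext n; simpa using h2 n
      rw [this, Nat.sInf_empty]

lemma measurable_comp_exitIndex {S : ℕ → Ω → ℝ} (hS : ∀ n, Measurable (S n))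
    {β : Type*} [MeasurableSpace β] {f : ℕ → Ω → β} (hf : ∀ n, Measurable (f n)) :
    Measurable (fun ω ↦ f (exitIndex S ω) ω) := by
  have h : Measurable (fun p : Ω × ℕ ↦ f p.2 p.1) := measurable_from_prod_countable_left hf
  exact h.comp (measurable_id.prodMk (measurable_exitIndex hS))

section OneStep

variable {P : Measure Ω} {X : ℕ → Ω → ℝ} {gap : ℕ → Ω → ℝ≥0}

/-- The past of the walk before its `n`-th step is independent of the `n`-th waiting time and
step. -/
lemma indepFun_past (hXm : ∀ n, Measurable (X n)) (hgm : ∀ n, Measurable (gap n))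
    (hY : iIndepFun (fun n ω ↦ (gap n ω, X n ω)) P) (n : ℕ) :
    IndepFun (fun ω (i : ℕ) ↦ if i < n then X i ω else 0) (fun ω ↦ (gap n ω, X n ω)) P := by
  have h := hY.indepFun_finset (Finset.range n) {n} (by simp) (fun i ↦ (hgm i).prodMk (hXm i))
  have hφ : Measurable (fun (y : Finset.range n → ℝ≥0 × ℝ) (i : ℕ) ↦
      if hi : i ∈ Finset.range n then (y ⟨i, hi⟩).2 else 0) := by
    refine measurable_pi_lambda _ fun i ↦ ?_
    by_cases hi : i ∈ Finset.range n
    · simp only [hi, dite_true]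
      exact measurable_snd.comp (measurable_pi_apply _)
    · simp only [hi, dite_false]
      exact measurable_const
  have hψ : Measurable (fun y : ({n} : Finset ℕ) → ℝ≥0 × ℝ ↦ y ⟨n, by simp⟩) :=
    measurable_pi_apply _
  have h' := h.comp hφ hψ
  have e : (fun ω (i : ℕ) ↦ if i < n then X i ω else 0) =
      (fun (y : Finset.range n → ℝ≥0 × ℝ) (i : ℕ) ↦
        if hi : i ∈ Finset.range n then (y ⟨i, hi⟩).2 else 0) ∘
        fun ω i ↦ (gap i ω, X i ω) := by
    ext ω i
    simp
  rw [e]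
  exact h'

lemma measurable_past (hXm : ∀ n, Measurable (X n)) (n : ℕ) :
    Measurable (fun ω (i : ℕ) ↦ if i < n then X i ω else 0) :=
  measurable_pi_lambda _ fun i ↦ by
    by_cases hi : i < n
    · simpa only [hi, if_true] using hXm i
    · simp only [hi, if_false]; exact measurable_const

/-- Markov property of the walk: the next step may be averaged out first. -/
lemma setIntegral_walk_succ [IsProbabilityMeasure P] {κ : Measure ℝ} [IsProbabilityMeasure κ]
    (hXm : ∀ n, Measurable (X n)) (hgm : ∀ n, Measurable (gap n))
    (hY : iIndepFun (fun n ω ↦ (gap n ω, X n ω)) P) (hκ : ∀ n, P.map (X n) = κ)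
    {f : ℝ → ℝ} (hf : Measurable f) (z : ℝ) (n : ℕ)
    (hi : Integrable (fun ω ↦ f (walk z X (n + 1) ω)) P) :
    ∫ ω in aliveSet (walk z X) n, f (walk z X (n + 1) ω) ∂P =
      ∫ ω in aliveSet (walk z X) n, ∫ x, f (walk z X n ω - x) ∂κ ∂P := by
  set V : Ω → ℕ → ℝ := fun ω i ↦ if i < n then X i ω else 0 with hV
  have hVm : Measurable V := measurable_past hXm n
  set E : ℕ → (ℕ → ℝ) → ℝ := fun i x ↦ x i with hE
  have hEm (m : ℕ) : Measurable (walk z E m) := measurable_walk (fun i ↦ measurable_pi_apply i) z m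
  set A : Set (ℕ → ℝ) := aliveSet (walk z E) n with hA
  have hAm : MeasurableSet A := measurableSet_aliveSet hEm n
  have halive : aliveSet (walk z X) n = V ⁻¹' A := by
    ext ω; exact mem_aliveSet_walk_iff_past z n ω
  have hwalk (ω : Ω) : walk z X n ω = walk z E n (V ω) := walk_eq_past z le_rfl ω
  have hind : IndepFun V (X n) P := (indepFun_past hXm hgm hY n).comp measurable_id measurable_snd
  have hlaw : P.map (fun ω ↦ (V ω, X n ω)) = (P.map V).prod κ := by
    rw [(indepFun_iff_map_prod_eq_prod_map_map hVm.aemeasurable (hXm n).aemeasurable).1 hind, hκ n]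
  have := Measure.isProbabilityMeasure_map (μ := P) hVm.aemeasurable
  have hVX : Measurable (fun ω ↦ (V ω, X n ω)) := hVm.prodMk (hXm n)
  set F : (ℕ → ℝ) × ℝ → ℝ := fun p ↦ f (walk z E n p.1 - p.2) with hF
  have hFm : Measurable F := hf.comp (((hEm n).comp measurable_fst).sub measurable_snd)
  have hFV (ω : Ω) : f (walk z X (n + 1) ω) = F (V ω, X n ω) := by
    rw [hF, walk_succ, hwalk]
  have hFi : Integrable F ((P.map V).prod κ) := by
    rw [← hlaw, integrable_map_measure hFm.aestronglyMeasurable hVX.aemeasurable]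
    exact hi.congr (ae_of_all _ hFV)
  have hset : V ⁻¹' A = (fun ω ↦ (V ω, X n ω)) ⁻¹' (A ×ˢ univ) := by ext; simp
  have hin : StronglyMeasurable (fun v ↦ ∫ x, F (v, x) ∂κ) :=
    hFm.stronglyMeasurable.integral_prod_right
  calc ∫ ω in aliveSet (walk z X) n, f (walk z X (n + 1) ω) ∂P
      = ∫ ω in (fun ω ↦ (V ω, X n ω)) ⁻¹' (A ×ˢ univ), F (V ω, X n ω) ∂P := by
        rw [halive, hset]; simp_rw [hFV]
    _ = ∫ p in A ×ˢ univ, F p ∂(P.map V).prod κ := by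
        rw [← hlaw, setIntegral_map (hAm.prod MeasurableSet.univ) hFm.aestronglyMeasurable
          hVX.aemeasurable]
    _ = ∫ v in A, ∫ x, F (v, x) ∂κ ∂P.map V := by
        rw [setIntegral_prod _ hFi.integrableOn, Measure.restrict_univ]
    _ = ∫ ω in V ⁻¹' A, ∫ x, F (V ω, x) ∂κ ∂P := by
        rw [setIntegral_map hAm hin.aestronglyMeasurable hVm.aemeasurable]
    _ = _ := by rw [halive]; simp only [hF, hwalk]

lemma setLIntegral_gap (hXm : ∀ n, Measurable (X n))
    (hgm : ∀ n, Measurable (gap n)) (hY : iIndepFun (fun n ω ↦ (gap n ω, X n ω)) P) (z : ℝ)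
    (n : ℕ) :
    ∫⁻ ω in aliveSet (walk z X) n, gap n ω ∂P =
      P (aliveSet (walk z X) n) * ∫⁻ ω, gap n ω ∂P := by
  have hEm (m : ℕ) : Measurable (walk z (fun i (x : ℕ → ℝ) ↦ x i) m) :=
    measurable_walk (fun i ↦ measurable_pi_apply i) z m
  have hAm := measurableSet_aliveSet hEm n
  have hSm := measurableSet_aliveSet (measurable_walk hXm z) n
  set V : Ω → ℕ → ℝ := fun ω i ↦ if i < n then X i ω else 0 with hV
  have hone : Measurable
      (indicator (aliveSet (walk z fun i (x : ℕ → ℝ) ↦ x i) n) fun _ ↦ (1 : ENNReal)) :=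
    measurable_const.indicator hAm
  have hind := (indepFun_past hXm hgm hY n).comp hone
    (measurable_coe_nnreal_ennreal.comp measurable_fst)
  have h := lintegral_mul_eq_lintegral_mul_lintegral_of_indepFun
    (hone.comp (measurable_past hXm n))
    (measurable_coe_nnreal_ennreal.comp (hgm n)) hind
  have hi (ω : Ω) : indicator (aliveSet (walk z fun i (x : ℕ → ℝ) ↦ x i) n) (fun _ ↦ (1 : ENNReal))
      (V ω) = indicator (aliveSet (walk z X) n) (fun _ ↦ (1 : ENNReal)) ω := by
    have hiff := mem_aliveSet_walk_iff_past (X := X) z n ω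
    by_cases hω : ω ∈ aliveSet (walk z X) n
    · rw [indicator_of_mem hω, indicator_of_mem (hiff.1 hω)]
    · rw [indicator_of_notMem hω, indicator_of_notMem (fun h ↦ hω (hiff.2 h))]
  simp only [Pi.mul_apply, Function.comp_apply] at h
  change ∫⁻ ω, indicator _ _ (V ω) * _ ∂P = (∫⁻ ω, indicator _ _ (V ω) ∂P) * _ at h
  simp_rw [hi] at h
  rw [lintegral_indicator hSm, lintegral_one, Measure.restrict_apply_univ] at h
  rw [← h, ← lintegral_indicator hSm]
  refine lintegral_congr fun ω ↦ ?_
  by_cases hω : ω ∈ aliveSet (walk z X) n <;> simp [hω]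

end OneStep

end Walk

/-! ### The walk with asymmetric Laplace steps -/

lemma setIntegral_aliveSet_zero_walk_one {Ω : Type*} [MeasurableSpace Ω] {P : Measure Ω}
    {X : ℕ → Ω → ℝ} {α β : ℝ} (hXm : ∀ n, Measurable (X n))
    (hX : ∀ n, P.map (X n) = asymLaplace α β) {f : ℝ → ℝ} (hf : Measurable f) (z : ℝ) :
    ∫ ω in aliveSet (walk z X) 0, f (walk z X 1 ω) ∂P =
      ∫ x, f (z - x) ∂asymLaplace α β := by
  have hm : Measurable (fun x ↦ f (z - x)) := hf.comp (by fun_prop)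
  rw [aliveSet_zero, Measure.restrict_univ, ← hX 0,
    integral_map (hXm 0).aemeasurable hm.aestronglyMeasurable]
  simp [walk]

lemma setIntegral_timeFn_one {Ω : Type*} [MeasurableSpace Ω] {P : Measure Ω}
    {X : ℕ → Ω → ℝ} {α β : ℝ} (hXm : ∀ n, Measurable (X n))
    (hX : ∀ n, P.map (X n) = asymLaplace α β) (z : ℝ) :
    ∫ ω in aliveSet (walk z X) 1, timeFn α (walk z X 1 ω) ∂P =
      ∫ x, timeFn α (z - x) ∂asymLaplace α β := by
  have hA := measurableSet_aliveSet (measurable_walk hXm z)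
  rw [← setIntegral_aliveSet_zero_walk_one hXm hX (measurable_timeFn α) z]
  refine (setIntegral_eq_of_subset_of_forall_sdiff_eq_zero (hA _)
      (aliveSet_succ_subset _ _) ?_).symm
  intro ω hω
  exact timeFn_of_nonpos (not_lt.1 fun h ↦ hω.2 (mem_aliveSet_succ.2 ⟨hω.1, h⟩))

section Ladder

variable {Ω : Type*} [MeasurableSpace Ω] {P : Measure Ω} [IsProbabilityMeasure P]
  {X : ℕ → Ω → ℝ} {gap : ℕ → Ω → ℝ≥0} {α β : ℝ}

lemma integrable_walk (hXm : ∀ n, Measurable (X n))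
    (hX : ∀ n, P.map (X n) = asymLaplace α β) (hα : 0 < α) (hβ : 0 < β) (z : ℝ) (n : ℕ) :
    Integrable (walk z X n) P := by
  have h (i : ℕ) : Integrable (X i) P := by
    have : Integrable (fun x : ℝ ↦ x) (P.map (X i)) := by
      rw [hX i]
      exact integrable_asymLaplace (integrable_id_expMeasure hα) (integrable_id_expMeasure hβ).neg
    exact (integrable_map_measure (by fun_prop) (hXm i).aemeasurable).1 this
  exact (integrable_const z).sub (integrable_finsetSum _ fun i _ ↦ h i)

/-- The exponential moment of the walk at any `θ` strictly between `0` and `β` is geometric. -/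
lemma integral_exp_walk (hXm : ∀ n, Measurable (X n)) (hXi : iIndepFun X P)
    (hX : ∀ n, P.map (X n) = asymLaplace α β) (hα : 0 < α) (hβ : 0 < β) {θ : ℝ} (hθ : 0 < θ)
    (hθβ : θ < β) (z : ℝ) (n : ℕ) :
    Integrable (fun ω ↦ Real.exp (θ * walk z X n ω)) P ∧
    ∫ ω, Real.exp (θ * walk z X n ω) ∂P =
      Real.exp (θ * z) * (α * β / ((α + θ) * (β - θ))) ^ n := by
  have he (ω : Ω) : Real.exp (θ * walk z X n ω) =
      Real.exp (θ * z) * Real.exp (-θ * (∑ i ∈ Finset.range n, X i) ω) := by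
    rw [walk, ← Real.exp_add, Finset.sum_apply]; ring_nf
  have hr (x : ℝ) : Real.exp (-θ * x) = Real.exp (θ * (0 - x)) := by ring_nf
  have hm : Measurable (fun x ↦ Real.exp (θ * (0 - x))) := by fun_prop
  have hint (i : ℕ) : Integrable (fun ω ↦ Real.exp (-θ * X i ω)) P := by
    simp_rw [hr]
    have := integrable_exp_mul_sub_asymLaplace hα hβ hθ hθβ 0
    rw [← hX i] at this
    exact (integrable_map_measure hm.aestronglyMeasurable (hXm i).aemeasurable).1 this
  have hmgf (i : ℕ) : mgf (X i) P (-θ) = α * β / ((α + θ) * (β - θ)) := by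
    have := integral_exp_mul_sub_asymLaplace hα hβ hθ hθβ 0
    rw [← hX i, integral_map (hXm i).aemeasurable hm.aestronglyMeasurable] at this
    rw [mgf]
    simp_rw [hr]
    simpa using this
  simp_rw [he]
  refine ⟨(hXi.integrable_exp_mul_sum hXm fun i _ ↦ hint i).const_mul _, ?_⟩
  rw [integral_const_mul]
  have := hXi.mgf_sum hXm (Finset.range n) (t := -θ)
  rw [mgf] at this
  rw [this, Finset.prod_congr rfl (fun i _ ↦ hmgf i), Finset.prod_const, Finset.card_range]

lemma timeFn_le_exp {θ : ℝ} (hα : 0 < α) (hθ : 0 < θ) (y : ℝ) :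
    timeFn α y ≤ (1 / θ + 1 / α) * Real.exp (θ * y) := by
  rcases le_or_gt y 0 with hy | hy
  · rw [timeFn_of_nonpos hy]; positivity
  · rw [timeFn_of_pos hy, add_mul]
    have h1 := Real.add_one_le_exp (θ * y)
    have h2 : 1 ≤ Real.exp (θ * y) := by nlinarith
    have h3 : 1 / α ≤ 1 / α * Real.exp (θ * y) := le_mul_of_one_le_right (by positivity) h2
    have h4 : y ≤ 1 / θ * Real.exp (θ * y) := by
      rw [div_mul_eq_mul_div, one_mul, le_div_iff₀ hθ]; nlinarith
    linarith

lemma integrable_timeFn_walk (hXm : ∀ n, Measurable (X n))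
    (hX : ∀ n, P.map (X n) = asymLaplace α β) (hα : 0 < α) (hβ : 0 < β) (z : ℝ) (n : ℕ) :
    Integrable (fun ω ↦ timeFn α (walk z X n ω)) P :=
  integrable_timeFn hα (measurable_walk hXm z n) (integrable_walk hXm hX hα hβ z n)

/-- The order dies out: the expectation of `timeFn` over the survival event tends to `0`. Choosing
`θ` halfway between the roots `0` and `β - α` makes the exponential moment decay geometrically. -/
lemma tendsto_setIntegral_timeFn (hXm : ∀ n, Measurable (X n)) (hXi : iIndepFun X P)
    (hX : ∀ n, P.map (X n) = asymLaplace α β) (hα : 0 < α) (hαβ : α < β) (z : ℝ) :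
    Tendsto (fun n ↦ ∫ ω in aliveSet (walk z X) n, timeFn α (walk z X n ω) ∂P) atTop (𝓝 0) := by
  have hβ : 0 < β := hα.trans hαβ
  obtain ⟨θ, hθdef⟩ : ∃ θ, θ = (β - α) / 2 := ⟨_, rfl⟩
  have hθ : 0 < θ := by rw [hθdef]; linarith
  have hθβ : θ < β := by rw [hθdef]; linarith
  set ρ := α * β / ((α + θ) * (β - θ)) with hρ
  have hden : 0 < (α + θ) * (β - θ) := mul_pos (by linarith) (by linarith)
  have hρ0 : 0 ≤ ρ := by positivity
  have hρ1 : ρ < 1 := by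
    rw [hρ, div_lt_one hden]
    nlinarith
  have hlim : Tendsto (fun n ↦ (1 / θ + 1 / α) * (Real.exp (θ * z) * ρ ^ n)) atTop (𝓝 0) := by
    simpa using ((tendsto_pow_atTop_nhds_zero_of_lt_one hρ0 hρ1).const_mul
      (Real.exp (θ * z))).const_mul (1 / θ + 1 / α)
  refine squeeze_zero (fun n ↦ integral_nonneg fun ω ↦ timeFn_nonneg hα _) (fun n ↦ ?_) hlim
  have he := integral_exp_walk hXm hXi hX hα hβ hθ hθβ z n
  have hi := integrable_timeFn_walk hXm hX hα hβ z n
  calc ∫ ω in aliveSet (walk z X) n, timeFn α (walk z X n ω) ∂P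
      ≤ ∫ ω, timeFn α (walk z X n ω) ∂P :=
        setIntegral_le_integral hi (ae_of_all _ fun ω ↦ timeFn_nonneg hα _)
    _ ≤ ∫ ω, (1 / θ + 1 / α) * Real.exp (θ * walk z X n ω) ∂P :=
        integral_mono hi (he.1.const_mul _) fun ω ↦ timeFn_le_exp hα hθ _
    _ = _ := by rw [integral_const_mul, he.2]

/-- From time `1` on, `timeFn` decreases on average by `1 / α - 1 / β` as long as the order is
alive. -/
lemma setIntegral_timeFn_succ (hXm : ∀ n, Measurable (X n)) (hgm : ∀ n, Measurable (gap n))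
    (hY : iIndepFun (fun n ω ↦ (gap n ω, X n ω)) P)
    (hX : ∀ n, P.map (X n) = asymLaplace α β) (hα : 0 < α) (hβ : 0 < β) (z : ℝ) (n : ℕ) :
    ∫ ω in aliveSet (walk z X) (n + 2), timeFn α (walk z X (n + 2) ω) ∂P =
      ∫ ω in aliveSet (walk z X) (n + 1), timeFn α (walk z X (n + 1) ω) ∂P -
        (1 / α - 1 / β) * P.real (aliveSet (walk z X) (n + 1)) := by
  have := isProbabilityMeasure_asymLaplace hα hβ
  have hSm := measurable_walk hXm z
  have hA := measurableSet_aliveSet hSm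
  have h0 : ∫ ω in aliveSet (walk z X) (n + 2), timeFn α (walk z X (n + 2) ω) ∂P =
      ∫ ω in aliveSet (walk z X) (n + 1), timeFn α (walk z X (n + 2) ω) ∂P := by
    refine (setIntegral_eq_of_subset_of_forall_sdiff_eq_zero (hA _)
      (aliveSet_succ_subset _ _) ?_).symm
    intro ω hω
    refine timeFn_of_nonpos (not_lt.1 fun h ↦ hω.2 (mem_aliveSet_succ.2 ⟨hω.1, h⟩))
  have hi := integrable_timeFn_walk hXm hX hα hβ z (n + 1)
  rw [h0, setIntegral_walk_succ hXm hgm hY hX (measurable_timeFn α) z (n + 1)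
    (integrable_timeFn_walk hXm hX hα hβ z (n + 2))]
  have h1 : ∫ ω in aliveSet (walk z X) (n + 1),
      ∫ x, timeFn α (walk z X (n + 1) ω - x) ∂asymLaplace α β ∂P =
      ∫ ω in aliveSet (walk z X) (n + 1),
        (timeFn α (walk z X (n + 1) ω) - (1 / α - 1 / β)) ∂P := by
    refine setIntegral_congr_fun (hA _) fun ω hω ↦ ?_
    have hpos := (mem_aliveSet_succ.1 hω).2
    rw [integral_timeFn_of_nonneg hα hβ hpos.le, timeFn_of_pos hpos]
    ring
  rw [h1, integral_sub hi.integrableOn (integrable_const _), setIntegral_const, smul_eq_mul,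
    mul_comm]

/-- The expected number of blocks up to the fill, as a sum of survival probabilities: these are the
telescoping differences of the expectation of `timeFn` over the survival events. -/
lemma hasSum_measureReal_aliveSet (hXm : ∀ n, Measurable (X n)) (hgm : ∀ n, Measurable (gap n))
    (hY : iIndepFun (fun n ω ↦ (gap n ω, X n ω)) P)
    (hX : ∀ n, P.map (X n) = asymLaplace α β) (hα : 0 < α) (hαβ : α < β) (z : ℝ) :
    HasSum (fun n ↦ P.real (aliveSet (walk z X) n))
      (1 + (∫ x, timeFn α (z - x) ∂asymLaplace α β) / (1 / α - 1 / β)) := by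
  have hβ : 0 < β := hα.trans hαβ
  have hc : 0 < 1 / α - 1 / β := sub_pos.2 (one_div_lt_one_div_of_lt hα hαβ)
  have hXi : iIndepFun X P := hY.comp (fun _ p ↦ p.2) (fun _ ↦ measurable_snd)
  rw [← hasSum_nat_add_iff' 1, hasSum_iff_tendsto_nat_of_nonneg fun n ↦ measureReal_nonneg]
  set a : ℕ → ℝ := fun n ↦ ∫ ω in aliveSet (walk z X) n, timeFn α (walk z X n ω) ∂P with ha
  have hsum (n : ℕ) : ∑ i ∈ Finset.range n, P.real (aliveSet (walk z X) (i + 1)) =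
      (a 1 - a (n + 1)) / (1 / α - 1 / β) := by
    induction n with
    | zero => simp
    | succ n ih =>
      have := setIntegral_timeFn_succ hXm hgm hY hX hα hβ z n
      rw [Finset.sum_range_succ, ih, div_add' _ _ _ hc.ne']
      congr 1
      simp only [ha]
      rw [this]
      ring
  simp_rw [hsum]
  have hlim := (tendsto_setIntegral_timeFn hXm hXi hX hα hαβ z).comp (tendsto_add_atTop_nat 1)
  have := (hlim.const_sub (a 1)).div_const (1 / α - 1 / β)
  have ha1 : a 1 = ∫ x, timeFn α (z - x) ∂asymLaplace α β := setIntegral_timeFn_one hXm hX z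
  simpa [aliveSet_zero, ← ha1] using this

lemma tendsto_measureReal_aliveSet (hXm : ∀ n, Measurable (X n)) (hgm : ∀ n, Measurable (gap n))
    (hY : iIndepFun (fun n ω ↦ (gap n ω, X n ω)) P)
    (hX : ∀ n, P.map (X n) = asymLaplace α β) (hα : 0 < α) (hαβ : α < β) (z : ℝ) :
    Tendsto (fun n ↦ P.real (aliveSet (walk z X) n)) atTop (𝓝 0) :=
  (hasSum_measureReal_aliveSet hXm hgm hY hX hα hαβ z).summable.tendsto_atTop_zero

lemma ae_exists_walk_nonpos (hXm : ∀ n, Measurable (X n)) (hgm : ∀ n, Measurable (gap n))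
    (hY : iIndepFun (fun n ω ↦ (gap n ω, X n ω)) P)
    (hX : ∀ n, P.map (X n) = asymLaplace α β) (hα : 0 < α) (hαβ : α < β) (z : ℝ) :
    ∀ᵐ ω ∂P, ∃ n, walk z X (n + 1) ω ≤ 0 := by
  -- The event of never being filled is contained in every `aliveSet`.
  rw [ae_iff, ← measureReal_eq_zero_iff]
  refine le_antisymm (ge_of_tendsto' (tendsto_measureReal_aliveSet hXm hgm hY hX hα hαβ z)
    fun n ↦ measureReal_mono fun ω hω k _ ↦ ?_) measureReal_nonneg
  exact not_le.1 fun h ↦ hω ⟨k, h⟩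

/-- The total waiting time up to the fill is the sum over all blocks of the waiting time,
restricted to the event that the order is still alive. -/
lemma lintegral_sum_gap (hXm : ∀ n, Measurable (X n)) (hgm : ∀ n, Measurable (gap n))
    (hY : iIndepFun (fun n ω ↦ (gap n ω, X n ω)) P)
    (hX : ∀ n, P.map (X n) = asymLaplace α β) (hα : 0 < α) (hαβ : α < β) (z : ℝ)
    {m : ℝ} (hm : 0 ≤ m) (hgap : ∀ n, ∫⁻ ω, gap n ω ∂P = ENNReal.ofReal m) :
    ∫⁻ ω, ((∑ i ∈ Finset.range (exitIndex (walk z X) ω + 1), gap i ω : ℝ≥0) : ENNReal) ∂P =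
      ENNReal.ofReal (m * (1 + (∫ x, timeFn α (z - x) ∂asymLaplace α β) / (1 / α - 1 / β))) := by
  have hA := measurableSet_aliveSet (measurable_walk hXm z)
  have h1 : ∀ᵐ ω ∂P, ((∑ i ∈ Finset.range (exitIndex (walk z X) ω + 1), gap i ω : ℝ≥0) : ENNReal) =
      ∑' n, (aliveSet (walk z X) n).indicator (fun ω ↦ (gap n ω : ENNReal)) ω := by
    filter_upwards [ae_exists_walk_nonpos hXm hgm hY hX hα hαβ z] with ω hω
    have hiff := mem_aliveSet_iff_le_exitIndex hω
    rw [tsum_eq_sum (s := Finset.range (exitIndex (walk z X) ω + 1)), ENNReal.ofNNReal_finsetSum]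
    · refine Finset.sum_congr rfl fun i hi ↦ ?_
      rw [indicator_of_mem ((hiff i).2 (by simpa [Nat.lt_succ_iff] using hi))]
    · intro i hi
      rw [indicator_of_notMem]
      rw [hiff]
      simpa using hi
  have hgm' (n : ℕ) : Measurable
      ((aliveSet (walk z X) n).indicator fun ω ↦ (gap n ω : ENNReal)) :=
    (measurable_coe_nnreal_ennreal.comp (hgm n)).indicator (hA n)
  rw [lintegral_congr_ae h1, lintegral_tsum fun n ↦ (hgm' n).aemeasurable]
  have h2 (n : ℕ) : ∫⁻ ω, (aliveSet (walk z X) n).indicator (fun ω ↦ (gap n ω : ENNReal)) ω ∂P =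
      ENNReal.ofReal (m * P.real (aliveSet (walk z X) n)) := by
    rw [lintegral_indicator (hA n), setLIntegral_gap hXm hgm hY, hgap n, mul_comm,
      ENNReal.ofReal_mul hm, ofReal_measureReal]
  simp_rw [h2]
  have hs := (hasSum_measureReal_aliveSet hXm hgm hY hX hα hαβ z).mul_left m
  rw [← hs.tsum_eq, ENNReal.ofReal_tsum_of_nonneg (fun n ↦ by positivity) hs.summable]

lemma integrable_lossFn_exit (hXm : ∀ n, Measurable (X n)) (hα : 0 < α) (z : ℝ) :
    Integrable (fun ω ↦ lossFn α (walk z X (exitIndex (walk z X) ω + 1) ω)) P := by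
  have hSm := measurable_walk hXm z
  exact integrable_lossFn hα (measurable_comp_exitIndex hSm fun n ↦ hSm (n + 1))

/-- Optional stopping for the loss: stopping at the fill does not change the expectation of
`lossFn` after one step. -/
lemma integral_lossFn_exit (hXm : ∀ n, Measurable (X n)) (hgm : ∀ n, Measurable (gap n))
    (hY : iIndepFun (fun n ω ↦ (gap n ω, X n ω)) P)
    (hX : ∀ n, P.map (X n) = asymLaplace α β) (hα : 0 < α) (hαβ : α < β) (z : ℝ) :
    ∫ ω, lossFn α (walk z X (exitIndex (walk z X) ω + 1) ω) ∂P =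
      ∫ x, lossFn α (z - x) ∂asymLaplace α β := by
  have hβ : 0 < β := hα.trans hαβ
  have := isProbabilityMeasure_asymLaplace hα hβ
  have hSm := measurable_walk hXm z
  have hA := measurableSet_aliveSet hSm
  set S := walk z X with hS
  set L : Ω → ℝ := fun ω ↦ lossFn α (S (exitIndex S ω + 1) ω) with hL
  have hLi : Integrable L P := integrable_lossFn_exit hXm hα z
  have hi (n : ℕ) : Integrable (fun ω ↦ lossFn α (S n ω)) P := integrable_lossFn hα (hSm n)
  set K : ℕ → ℝ := fun n ↦ ∫ ω in aliveSet S n, lossFn α (S (n + 1) ω) ∂P with hK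
  have hKsucc (n : ℕ) : K (n + 1) = 1 / (1 + α) * P.real (aliveSet S (n + 1)) := by
    simp only [hK, hS]
    rw [setIntegral_walk_succ hXm hgm hY hX (measurable_lossFn α) z (n + 1) (hi (n + 2))]
    have h1 : ∫ ω in aliveSet (walk z X) (n + 1),
        ∫ x, lossFn α (walk z X (n + 1) ω - x) ∂asymLaplace α β ∂P =
        ∫ ω in aliveSet (walk z X) (n + 1), 1 / (1 + α) ∂P :=
      setIntegral_congr_fun (hA _) fun ω hω ↦
        integral_lossFn_of_nonneg hα hβ (mem_aliveSet_succ.1 hω).2.le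
    rw [h1, setIntegral_const, smul_eq_mul, mul_comm]
  -- On `aliveSet S n \ aliveSet S (n + 1)` the order is filled by block `n`.
  have hstep (n : ℕ) : K n - K (n + 1) = ∫ ω in aliveSet S n, L ω ∂P -
      ∫ ω in aliveSet S (n + 1), L ω ∂P := by
    have hsub := aliveSet_succ_subset S n
    have e1 : ∫ ω in aliveSet S (n + 1), lossFn α (S (n + 1) ω) ∂P = K (n + 1) := by
      rw [hKsucc, setIntegral_congr_fun (hA _) (g := fun _ ↦ 1 / (1 + α)) fun ω hω ↦
        lossFn_of_pos (mem_aliveSet_succ.1 hω).2, setIntegral_const, smul_eq_mul, mul_comm]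
    rw [← e1]
    simp only [hK]
    rw [← setIntegral_sdiff (hA _) (hi _).integrableOn hsub,
      ← setIntegral_sdiff (hA _) hLi.integrableOn hsub]
    refine setIntegral_congr_fun ((hA _).diff (hA _)) fun ω hω ↦ ?_
    have hle : S (n + 1) ω ≤ 0 := not_lt.1 fun h ↦ hω.2 (mem_aliveSet_succ.2 ⟨hω.1, h⟩)
    simp only [hL, exitIndex_eq_of_mem hω.1 hle]
  have hconst (n : ℕ) : ∫ ω in aliveSet S n, L ω ∂P - K n = ∫ ω, L ω ∂P - K 0 := by
    induction n with
    | zero => rw [aliveSet_zero, Measure.restrict_univ]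
    | succ n ih => linarith [hstep n]
  have hP := tendsto_measureReal_aliveSet hXm hgm hY hX hα hαβ z
  have hbound {f : Ω → ℝ} (hf : ∀ ω, |f ω| ≤ 1) (n : ℕ) :
      ‖∫ ω in aliveSet S n, f ω ∂P‖ ≤ P.real (aliveSet S n) := by
    have := norm_setIntegral_le_of_norm_le_const (μ := P) (s := aliveSet S n) (f := f) (C := 1)
      (measure_lt_top _ _) (fun ω _ ↦ hf ω)
    simpa using this
  have l1 : Tendsto (fun n ↦ ∫ ω in aliveSet S n, L ω ∂P) atTop (𝓝 0) :=
    squeeze_zero_norm (hbound fun ω ↦ abs_lossFn_le hα _) hP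
  have l2 : Tendsto K atTop (𝓝 0) :=
    squeeze_zero_norm (fun n ↦ hbound (f := fun ω ↦ lossFn α (S (n + 1) ω))
      (fun ω ↦ abs_lossFn_le hα _) n) hP
  have l3 := l1.sub l2
  simp only [hconst, sub_zero] at l3
  have := tendsto_nhds_unique tendsto_const_nhds l3
  rw [sub_eq_zero.1 this, ← setIntegral_aliveSet_zero_walk_one hXm hX (measurable_lossFn α) z]

end Ladder

/-! ### The mispricing at the block times -/

/-- With `α = ζ₋` and `β = η`, the numbers `α` and `-β` are the roots of
`σ² s² / 2 + δ s - 1 / Δt`. -/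
lemma zetaMinus_relations {δ σ Δt : ℝ} (hδ : 0 < δ) (hσ : 0 < σ) (hΔt : 0 < Δt) :
    0 < zetaMinus δ σ Δt ∧
    zetaMinus δ σ Δt < δ / σ ^ 2 * (√(1 + 2 * σ ^ 2 / (δ ^ 2 * Δt)) + 1) ∧
    zetaMinus δ σ Δt * (δ / σ ^ 2 * (√(1 + 2 * σ ^ 2 / (δ ^ 2 * Δt)) + 1)) =
      2 * Δt⁻¹ / σ ^ 2 ∧
    δ / σ ^ 2 * (√(1 + 2 * σ ^ 2 / (δ ^ 2 * Δt)) + 1) - zetaMinus δ σ Δt = 2 * δ / σ ^ 2 := by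
  have hx : 0 < 2 * σ ^ 2 / (δ ^ 2 * Δt) := by positivity
  have hc : 0 < δ / σ ^ 2 := by positivity
  have hq1 : 1 < √(1 + 2 * σ ^ 2 / (δ ^ 2 * Δt)) := by
    rw [Real.lt_sqrt (by norm_num)]; linarith
  have hq2 := Real.sq_sqrt (show 0 ≤ 1 + 2 * σ ^ 2 / (δ ^ 2 * Δt) by positivity)
  set q := √(1 + 2 * σ ^ 2 / (δ ^ 2 * Δt))
  refine ⟨mul_pos hc (by linarith), mul_lt_mul_of_pos_left (by linarith) hc, ?_, ?_⟩
  · have : zetaMinus δ σ Δt * (δ / σ ^ 2 * (q + 1)) = (δ / σ ^ 2) ^ 2 * (q ^ 2 - 1) := by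
      rw [zetaMinus]; ring
    rw [this, hq2]
    field_simp
    ring
  · rw [zetaMinus]; ring

lemma mispricing_eq {Ω : Type*} {A₀ lam P₀ μ σ δ : ℝ} (hA₀ : 0 < A₀) (hP₀ : 0 < P₀)
    (hδ : δ = lam + μ - σ ^ 2 / 2) (W : ℝ≥0 → Ω → ℝ) (t : ℝ≥0) (ω : Ω) :
    mispricing A₀ lam P₀ μ σ W t ω = Real.log (A₀ / P₀) - (δ * t + σ * W t ω) := by
  rw [mispricing, ask, price, mul_div_mul_comm, ← Real.exp_sub,
    Real.log_mul (by positivity) (Real.exp_pos _).ne', Real.log_exp, hδ]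
  ring

lemma mispricing_blockTime_eq_walk {Ω : Type*} {A₀ lam P₀ μ σ δ : ℝ} (hA₀ : 0 < A₀)
    (hP₀ : 0 < P₀) (hδ : δ = lam + μ - σ ^ 2 / 2) {W : ℝ≥0 → Ω → ℝ} {gap : ℕ → Ω → ℝ≥0} {ω : Ω}
    (hc : Continuous fun t ↦ W t ω) (h0 : W 0 ω = 0) (n : ℕ) :
    mispricing A₀ lam P₀ μ σ W (blockTime gap n ω) ω =
      walk (Real.log (A₀ / P₀))
        (fun i ω ↦ driftStep δ σ (fun t ↦ W t ω) (fun n ↦ gap n ω) i) (n + 1) ω := by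
  rw [mispricing_eq hA₀ hP₀ hδ, walk, sum_driftStep, pathEval_of_continuous hc,
    pathEval_of_continuous hc, h0, sub_zero]
  rfl

lemma IsPoissonGaps.map_eq {Ω : Type*} [MeasurableSpace Ω] {P : Measure Ω} {gap : ℕ → Ω → ℝ≥0}
    {r : ℝ} (h : IsPoissonGaps gap r P) (n : ℕ) :
    P.map (gap n) = (expMeasure r).map Real.toNNReal := by
  have hm : Measurable (fun ω ↦ (gap n ω : ℝ)) := measurable_coe_nnreal_real.comp (h.measurable n)
  rw [← (h.law n).map_eq, Measure.map_map measurable_real_toNNReal hm]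
  congr 1
  ext ω
  simp

lemma map_coe_map_toNNReal_expMeasure (r : ℝ) :
    ((expMeasure r).map Real.toNNReal).map (fun t : ℝ≥0 ↦ (t : ℝ)) = expMeasure r := by
  rw [Measure.map_map measurable_coe_nnreal_real measurable_real_toNNReal]
  conv_rhs => rw [← Measure.map_id (μ := expMeasure r)]
  refine Measure.map_congr ?_
  filter_upwards [ae_nonneg_expMeasure r] with x hx
  simp [hx]

lemma IsPoissonGaps.lintegral_eq {Ω : Type*} [MeasurableSpace Ω] {P : Measure Ω}
    {gap : ℕ → Ω → ℝ≥0} {r : ℝ} (hr : 0 < r) (h : IsPoissonGaps gap r P) (n : ℕ) :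
    ∫⁻ ω, gap n ω ∂P = ENNReal.ofReal r⁻¹ := by
  have h1 : ∫⁻ ω, gap n ω ∂P = ∫⁻ x, ENNReal.ofReal x ∂expMeasure r := by
    have hm : Measurable (fun ω ↦ (gap n ω : ℝ)) :=
      measurable_coe_nnreal_real.comp (h.measurable n)
    rw [← (h.law n).map_eq, lintegral_map ENNReal.measurable_ofReal hm]
    simp
  rw [h1, ← ofReal_integral_eq_lintegral_ofReal (integrable_id_expMeasure hr)
    (ae_nonneg_expMeasure r), integral_id_expMeasure hr]

end DutchAuction

open DutchAuction in
theorem theorem1 {Ω : Type*} [MeasurableSpace Ω] (P : Measure Ω) [IsProbabilityMeasure P]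
    (μ σ lam Δt A₀ P₀ δ z₀ : ℝ)
    (hσ : 0 < σ) (hlam : 0 < lam) (hΔt : 0 < Δt) (hA₀ : 0 < A₀) (hP₀ : 0 < P₀)
    (hδ : δ = lam + μ - σ ^ 2 / 2) (hδpos : 0 < δ)
    (hz₀ : z₀ = Real.log (A₀ / P₀))
    (W : ℝ≥0 → Ω → ℝ) (hWmeas : ∀ t, Measurable (W t)) (hW : IsBrownianReal W P)
    (gap : ℕ → Ω → ℝ≥0) (hgap : DutchAuction.IsPoissonGaps gap Δt⁻¹ P)
    (hindep : IndepFun (fun ω t ↦ W t ω) (fun ω n ↦ gap n ω) P)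
    (z : ℝ≥0 → Ω → ℝ) (hz : z = DutchAuction.mispricing A₀ lam P₀ μ σ W) :
    (∀ᵐ ω ∂P, ∃ n, z (DutchAuction.blockTime gap n ω) ω ≤ 0) ∧
    Integrable (DutchAuction.relLoss z gap) P ∧
    Integrable (fun ω ↦ (DutchAuction.fillTime z gap ω : ℝ)) P ∧
    (0 ≤ z₀ →
      DutchAuction.LVF z gap P = 1 / (1 + DutchAuction.zetaMinus δ σ Δt) ∧
      DutchAuction.LVF z gap P =
        1 / (1 + δ / σ ^ 2 * (√(1 + 2 * σ ^ 2 / (δ ^ 2 * Δt)) - 1)) ∧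
      DutchAuction.FT z gap P =
        z₀ / δ + Δt / 2 * (1 + √(1 + 2 * σ ^ 2 / (δ ^ 2 * Δt)))) ∧
    (z₀ < 0 →
      (1 + Δt * (δ - σ ^ 2 / 2) ≠ 0 →
        DutchAuction.LVF z gap P =
          1 - Real.exp z₀ / (1 + Δt * (δ - σ ^ 2 / 2)) +
            (1 / (1 + DutchAuction.zetaMinus δ σ Δt) -
                Δt * (δ - σ ^ 2 / 2) / (1 + Δt * (δ - σ ^ 2 / 2))) *
              Real.exp (δ / σ ^ 2 * (√(1 + 2 * σ ^ 2 / (δ ^ 2 * Δt)) + 1) * z₀)) ∧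
      DutchAuction.FT z gap P =
        Δt / 2 * (2 + (√(1 + 2 * σ ^ 2 / (δ ^ 2 * Δt)) - 1) *
          Real.exp (δ / σ ^ 2 * (√(1 + 2 * σ ^ 2 / (δ ^ 2 * Δt)) + 1) * z₀))) := by
  obtain ⟨hα, hαβ, hmul, hsub⟩ := zetaMinus_relations hδpos hσ hΔt
  have hαdef : zetaMinus δ σ Δt = δ / σ ^ 2 * (√(1 + 2 * σ ^ 2 / (δ ^ 2 * Δt)) - 1) := rfl
  set α := zetaMinus δ σ Δt with hα'
  set β := δ / σ ^ 2 * (√(1 + 2 * σ ^ 2 / (δ ^ 2 * Δt)) + 1) with hβ'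
  have hβ : 0 < β := hα.trans hαβ
  have hr : 0 < Δt⁻¹ := inv_pos.2 hΔt
  set X : ℕ → Ω → ℝ := fun i ω ↦ driftStep δ σ (fun t ↦ W t ω) (fun n ↦ gap n ω) i with hXdef
  have hgm := hgap.measurable
  have hYm := measurable_gap_driftStep hWmeas hgm δ σ
  have hXm (n : ℕ) : Measurable (X n) := measurable_snd.comp (hYm n)
  have hY : iIndepFun (fun n ω ↦ (gap n ω, X n ω)) P :=
    iIndepFun_gap_driftStep hWmeas hW hgm hgap.indep hgap.map_eq hindep δ σ
  have := isProbabilityMeasure_expMeasure hr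
  have hX (n : ℕ) : P.map (X n) = asymLaplace α β := by
    rw [← map_snd_stepLaw (map_coe_map_toNNReal_expMeasure Δt⁻¹) hr hσ hα hβ hmul hsub,
      ← map_gap_driftStep hWmeas hW hgm hgap.indep hgap.map_eq hindep δ σ n,
      Measure.map_map measurable_snd (hYm n)]
    rfl
  have hSm := measurable_walk hXm z₀
  -- At the block times the log mispricing is the walk, outside a null set.
  have hzS : ∀ᵐ ω ∂P, ∀ n, z (blockTime gap n ω) ω = walk z₀ X (n + 1) ω := by
    filter_upwards [hW.cont, hW.toIsPreBrownianReal.eval_zero_ae_eq_zero] with ω hc h0 n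
    rw [hz, hz₀]
    exact mispricing_blockTime_eq_walk hA₀ hP₀ hδ hc h0 n
  have hfill : ∀ᵐ ω ∂P, fillBlock z gap ω = exitIndex (walk z₀ X) ω := by
    filter_upwards [hzS] with ω hω
    simp only [fillBlock, exitIndex, hω]
  have hex := ae_exists_walk_nonpos hXm hgm hY hX hα hαβ z₀
  have hloss : relLoss z gap =ᵐ[P]
      fun ω ↦ lossFn α (walk z₀ X (exitIndex (walk z₀ X) ω + 1) ω) := by
    filter_upwards [hzS, hfill, hex] with ω h1 h2 h3
    rw [relLoss, fillTime, h1, h2, lossFn_of_nonpos (exitIndex_spec h3)]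
  have htime : (fun ω ↦ (fillTime z gap ω : ENNReal)) =ᵐ[P] fun ω ↦
      ((∑ i ∈ Finset.range (exitIndex (walk z₀ X) ω + 1), gap i ω : ℝ≥0) : ENNReal) := by
    filter_upwards [hfill] with ω h2
    rw [fillTime, h2]
    rfl
  have hLVF : LVF z gap P = ∫ x, lossFn α (z₀ - x) ∂asymLaplace α β := by
    rw [LVF, integral_congr_ae hloss]
    exact integral_lossFn_exit hXm hgm hY hX hα hαβ z₀
  have hlint := lintegral_sum_gap hXm hgm hY hX hα hαβ z₀ hΔt.le
    (fun n ↦ by rw [hgap.lintegral_eq hr n, inv_inv])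
  rw [← lintegral_congr_ae htime] at hlint
  have hTm : AEMeasurable (fun ω ↦ (fillTime z gap ω : ℝ)) P := by
    have h : Measurable (fun ω ↦
        ((∑ i ∈ Finset.range (exitIndex (walk z₀ X) ω + 1), gap i ω : ℝ≥0) : ℝ)) :=
      measurable_comp_exitIndex hSm
        (f := fun n ω ↦ ((∑ i ∈ Finset.range (n + 1), gap i ω : ℝ≥0) : ℝ))
        fun n ↦ measurable_coe_nnreal_real.comp (Finset.measurable_sum _ fun i _ ↦ hgm i)
    refine ⟨_, h, ?_⟩
    filter_upwards [hfill] with ω h2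
    rw [fillTime, h2]
    rfl
  have hc : 1 / α - 1 / β = δ * Δt := by
    have : 1 / α - 1 / β = (β - α) / (α * β) := by field_simp
    rw [this, hmul, hsub]
    field_simp
  have hTint : Integrable (fun ω ↦ (fillTime z gap ω : ℝ)) P := by
    refine ⟨hTm.aestronglyMeasurable, ?_⟩
    rw [hasFiniteIntegral_iff_ofReal (ae_of_all _ fun ω ↦ NNReal.coe_nonneg _)]
    simp only [ENNReal.ofReal_coe_nnreal]
    rw [hlint]
    exact ENNReal.ofReal_lt_top
  have hτ : 0 ≤ ∫ x, timeFn α (z₀ - x) ∂asymLaplace α β :=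
    integral_nonneg fun x ↦ timeFn_nonneg hα _
  have hFT : FT z gap P = Δt + (∫ x, timeFn α (z₀ - x) ∂asymLaplace α β) / δ := by
    rw [FT, integral_eq_lintegral_of_nonneg_ae (ae_of_all _ fun ω ↦ NNReal.coe_nonneg _)
      hTm.aestronglyMeasurable]
    simp only [ENNReal.ofReal_coe_nnreal]
    rw [hlint, hc, ENNReal.toReal_ofReal (by positivity)]
    field_simp
  have hβinv : 1 / β = δ * Δt / 2 * (√(1 + 2 * σ ^ 2 / (δ ^ 2 * Δt)) - 1) := by
    have h1 : α * (σ ^ 2 * Δt / 2) = δ * Δt / 2 * (√(1 + 2 * σ ^ 2 / (δ ^ 2 * Δt)) - 1) := by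
      rw [hαdef]; field_simp
    rw [← h1, div_eq_iff hβ.ne']
    have h2 : α * (σ ^ 2 * Δt / 2) * β = α * β * (σ ^ 2 * Δt / 2) := by ring
    rw [h2, hmul]
    field_simp
  refine ⟨?_, ?_, hTint, fun hz0 ↦ ?_, fun hz0 ↦ ⟨fun hne ↦ ?_, ?_⟩⟩
  · filter_upwards [hzS, hex] with ω h1 h3
    simpa only [h1] using h3
  · exact (integrable_congr hloss).2 (integrable_lossFn_exit hXm hα z₀)
  · have hL : LVF z gap P = 1 / (1 + α) := by
      rw [hLVF, integral_lossFn_of_nonneg hα hβ hz0]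
    refine ⟨hL, by rw [hL, hαdef], ?_⟩
    rw [hFT, integral_timeFn_of_nonneg hα hβ hz0, hβinv]
    field_simp
    ring
  · -- The denominator vanishes exactly for `β = 1`.
    have hD : 1 + Δt * (δ - σ ^ 2 / 2) = (1 + α) * (β - 1) / (α * β) := by
      have : (1 + α) * (β - 1) = α * β + (β - α) - 1 := by ring
      rw [this, hmul, hsub]
      field_simp
      ring
    have hβ1 : β - 1 ≠ 0 := by
      intro h
      rw [hD, h] at hne
      simp at hne
    have hD' : Δt * (δ - σ ^ 2 / 2) = (1 + α) * (β - 1) / (α * β) - 1 := by linarith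
    rw [hLVF, integral_lossFn_of_neg hα hβ (sub_ne_zero.1 hβ1) hz0, hD, hD']
    have : 1 + α ≠ 0 := by positivity
    field_simp
    ring
  · rw [hFT, integral_timeFn_of_neg hα hβ hz0, div_eq_mul_one_div _ β, hβinv]
    field_simp
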